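/- Let $n\ge 3$ and let $L=(l_1,\dots,l_n)$ be a planar polygonal linkage. Its moduli space $\mathcal M(L)$ is the set of all $P=(p_1,\dots,p_n)$, $p_i\in\mathbb R^2$, with $|p_ip_{i+1}|=l_i$ for all $i$ (indices cyclic, $p_{n+1}=p_1$), $p_1=(0,0)$ and $p_2=(0,l_1)$. Let $A(P)=\frac12\sum_{i=1}^n\det(p_i,p_{i+1})$ be the signed area. For a closed polygon $Q=(q_1,\dots,q_k)$ with vertices on a circle with center $O$, call $Q$ central if one of its edges passes through $O$. If $Q$ has no vanishing edge and is not central, put $\varepsilon_i=1$ if $O$ lies to the left of the directed edge $q_iq_{i+1}$ and $\varepsilon_i=-1$ if it lies to the right; let $\alpha_i$ be half of the unoriented angle between $\overrightarrow{Oq_i}$ and $\overrightarrow{Oq_{i+1}}$; let $e(Q)$ be the number of $i$ with $\varepsilon_i=1$, let $\delta(Q)=\sum_{i=1}^k\varepsilon_i\tan\alpha_i$, and let $d(Q)$ be the sign of $\delta(Q)$. Let $P=(p_1,\dots,p_n)\in\mathcal M(L)$ be cyclic, i.e. all its vertices lie on a circle, with center $O$, and put $P_i=(p_1,\dots,p_i)$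 for $i=3,\dots,n$ (a closed polygon with last edge $p_ip_1$). Assume that $P$ is generic: for every $i=3,\dots,n$ the polygon $P_i$ has no vanishing edge, is not central, and $\delta(P_i)\neq0$. Then, for each $i=3,\dots,n$, the moduli space $\mathcal M(L_i)$ of the linkage $L_i$ formed by the edge lengths of $P_i$ is, near $P_i$, a smooth submanifold of dimension $i-3$ of the space of $i$-gons, and $P_i$ is a critical point of the signed area on it. Let $\mathcal H(P_i)$ be the sign of the determinant of the Hessian of the signed area at $P_i$, in arbitrary smooth local coordinates of $\mathcal M(L_i)$, for $i=4,\dots,n$, and put $\mathcal H(P_3)=1$. Then the Morse index of the signed area on $\mathcal M(L)$ at $P$ (the maximal dimension of a subspace on which the Hessian is negative definite) equals the number of sign changes in the sequence $$\mathcal H(P_3),\ \mathcal H(P_4),\ \dots,\ \mathcal H(P_n),$$ and $$\mathcal H(P_i)=-d(P_i)\,(-1)^{e(P_i)}\qquad\text{for } i=3,\dots,n.$$ -/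

import Mathlib

open scoped ContDiff

noncomputable section

/-- The Euclidean plane. -/
abbrev Plane := EuclideanSpace ℝ (Fin 2)

/-- The determinant `det (u, v)`; it is positive iff `v` points to the left of the direction `u`. -/
def cross (u v : Plane) : ℝ := u 0 * v 1 - u 1 * v 0

/-- Closed planar polygons with `n = m + 3` vertices `q 0, …, q (m + 2)` (so `q i` is the vertex
`p_{i+1}` in one-based numbering). The numeration is cyclic: in `Fin (m + 3)` the index `i + 1`
after the last one is `0`. The `i`-th edge goes from `q i` to `q (i + 1)`. -/
abbrev PlanarPolygon (m : ℕ) := Fin (m + 3) → Plane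

namespace PlanarPolygon

variable {m : ℕ}

/-- The edge lengths of a polygon. -/
def sideLengths (q : PlanarPolygon m) : Fin (m + 3) → ℝ := fun i => dist (q i) (q (i + 1))

/-- The signed area (shoelace formula). -/
def signedArea (q : PlanarPolygon m) : ℝ := (1 / 2) * ∑ i, cross (q i) (q (i + 1))

/-- All the vertices lie on the circle with centre `O` and radius `r`. -/
def InscribedIn (q : PlanarPolygon m) (O : Plane) (r : ℝ) : Prop := ∀ i, dist (q i) O = r

/-- The polygon is central: one of its edges passes through the centre `O`. -/
def IsCentral (q : PlanarPolygon m) (O : Plane) : Prop := ∃ i, O ∈ segment ℝ (q i) (q (i + 1))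

open Classical in
/-- Orientation `ε_i` of the `i`-th edge of a non-central inscribed polygon: `1` if the centre lies
to the left of the edge, `-1` if it lies to the right. -/
def orientation (q : PlanarPolygon m) (O : Plane) (i : Fin (m + 3)) : ℝ :=
  if 0 < cross (q (i + 1) - q i) (O - q i) then 1 else -1

/-- `α_i`: half of the (unoriented) angle between the vectors from the centre to the endpoints of
the `i`-th edge. -/
def halfAngle (q : PlanarPolygon m) (O : Plane) (i : Fin (m + 3)) : ℝ :=
  InnerProductGeometry.angle (q i - O) (q (i + 1) - O) / 2

/-- `δ = ∑ ε_i tan α_i`. -/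
def delta (q : PlanarPolygon m) (O : Plane) : ℝ :=
  ∑ i, orientation q O i * Real.tan (halfAngle q O i)

open Classical in
/-- The number `e` of positively oriented edges. -/
def numPositive (q : PlanarPolygon m) (O : Plane) : ℕ :=
  (Finset.univ.filter fun i => orientation q O i = 1).card

/-- The subconfiguration formed by the first `k + 3` vertices. -/
def sub (q : PlanarPolygon m) (k : Fin (m + 1)) : PlanarPolygon (k : ℕ) :=
  fun j => q (Fin.castLE (by omega) j)

/-- Genericity of a polygon inscribed in a circle with centre `O`: the polygon and each of the
subconfigurations formed by its first `3, 4, …` vertices has no vanishing edge, is non-central, and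
has `δ ≠ 0`. -/
structure IsGeneric (q : PlanarPolygon m) (O : Plane) : Prop where
  edge_ne : ∀ k i, q.sub k i ≠ q.sub k (i + 1)
  not_central : ∀ k, ¬ (q.sub k).IsCentral O
  delta_ne : ∀ k, (q.sub k).delta O ≠ 0

end PlanarPolygon

/-- The moduli space of the linkage `L`: the polygons with edge lengths `L` whose first two
vertices are pinned at `(0, 0)` and `(0, l_1)`. It carries the topology induced from the space of
all polygons. -/
def moduliSpace {m : ℕ} (L : Fin (m + 3) → ℝ) : Set (PlanarPolygon m) :=
  {q | q.sideLengths = L ∧ q 0 = 0 ∧ q 1 = !₂[0, L 0]}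

/-- A smooth local parametrization, with `m = n - 3` parameters, of the moduli space of `L` around
a configuration `q`: a homeomorphism from an open neighbourhood of `0` in `ℝ^m` onto an open
neighbourhood of `q` in the moduli space which sends `0` to `q` and is a smooth immersion into the
space of all polygons. -/
structure LocalParam {m : ℕ} (L : Fin (m + 3) → ℝ) (q : PlanarPolygon m) where
  chart : OpenPartialHomeomorph (EuclideanSpace ℝ (Fin m)) (moduliSpace L)
  zero_mem : 0 ∈ chart.source
  map_zero : (chart 0 : PlanarPolygon m) = q
  contDiffOn : ContDiffOn ℝ ∞ (fun x => (chart x : PlanarPolygon m)) chart.source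
  injective_fderiv : ∀ x ∈ chart.source,
    Function.Injective (fderiv ℝ (fun x => (chart x : PlanarPolygon m)) x)

namespace LocalParam

variable {m : ℕ} {L : Fin (m + 3) → ℝ} {q : PlanarPolygon m}

/-- The signed area in the local coordinates. -/
def area (φ : LocalParam L q) (x : EuclideanSpace ℝ (Fin m)) : ℝ :=
  PlanarPolygon.signedArea (φ.chart x : PlanarPolygon m)

/-- `q` is a critical point of the signed area on the moduli space. -/
def IsCritical (φ : LocalParam L q) : Prop := fderiv ℝ φ.area 0 = 0

/-- The Hessian of the signed area at `q`, in the local coordinates. -/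
def hess (φ : LocalParam L q) : Matrix (Fin m) (Fin m) ℝ :=
  Matrix.of fun i j => fderiv ℝ (fderiv ℝ φ.area) 0
    (EuclideanSpace.single i 1) (EuclideanSpace.single j 1)

/-- The sign of the determinant of the Hessian. -/
def hessSign (φ : LocalParam L q) : SignType := SignType.sign φ.hess.det

/-- The Morse index: the maximal dimension of a subspace on which the Hessian is negative
definite. -/
def morseIndex (φ : LocalParam L q) : ℕ := sigNeg φ.hess.toQuadraticForm'

end LocalParam

/-- The number of sign changes in the sequence `s 0, …, s m`. -/
def signChanges {m : ℕ} (s : Fin (m + 1) → SignType) : ℕ :=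
  (Finset.univ.filter fun k : Fin m => s k.castSucc * s k.succ = -1).card

/-- The sequence of the Hessian signs of the subconfigurations with `3, 4, …, m + 3` vertices, where
the sign for the triangle is put equal to `1`. -/
def hessSignSeq {m : ℕ} {p : PlanarPolygon m}
    (φ : ∀ k : Fin (m + 1), LocalParam (p.sub k).sideLengths (p.sub k)) :
    Fin (m + 1) → SignType :=
  fun k => if k = 0 then 1 else (φ k).hessSign

end

/-!
Let `x i = p i - O`, a family of vectors of length `r`. An infinitesimal motion of the polygon which
preserves the edge lengths rotates the `i`-th edge with some angular velocity `θ i`; that the edges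
keep closing up means that `τ i = θ (i - 1) - θ i` satisfies `∑ τ i = 0` and `∑ τ i • x i = 0`
(`PlanarPolygon.bendingMap`). So the tangent space of the moduli space at `p` is the space of affine
relations between the vertices, and the tangent spaces at the subconfigurations form the flag of
the relations which involve only the first `3, 4, …` vertices.

The signed area and the squared edge lengths are quadratic functions of the vertices. A cyclic
polygon is a critical point of a quadratic Lagrange function
(`PlanarPolygon.lagrangian_self_eq_zero`), so the Hessian of the area in any local coordinates is
this Lagrange function on the tangent space. Summation by parts
(`PlanarPolygon.two_mul_lagrangian_eq_chainForm`) turns it into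
`∑_{j < i} τ j * τ i * cross (x j) (x i)`, that is, twice the area of the closed polygonal chain with
edges `τ i • x i`. This area form lives on the larger space of all linear relations `∑ τ i • x i = 0`,
where its signature is found by orthogonal splittings:

* `linearForm_split`: extending the two neighbours of the last edge of a chain until they meet
  splits off a triangle with edges along the last two of the `x i` and `x 0`, whose area has the sign
  of a product of three determinants. By induction the area form on linear relations is
  nondegenerate, and the sign of its determinant is `-(-1) ^ e` (`linearForm_signature`).
* `linearForm_split_affine`: the functional `∑ τ i` is represented, with respect to the area form, by
  the polygon of tangent lines to the circle at the vertices (its area is `r / 2` times its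
  perimeter). The perimeter is proportional to `δ`, so that passing to affine relations multiplies
  the sign of the determinant by the sign of `δ`.

This gives the formula for the Hessian signs. As the area forms of the subconfigurations are
nondegenerate and are the restrictions of one form to a full flag, their negative indices grow by
`0` or `1` at each step, and they grow exactly when the sign of the determinant changes
(`sigNeg_affineForm_snoc`, `signChanges_neg_one_pow`).

The moduli spaces are manifolds near the polygons in question, by the inverse function theorem: the
kernel of the differential of the constraints embeds into the space of affine relations, whose
dimension is the expected one (`exists_chart_levelSet`, `PlanarPolygon.nonempty_localParam`).
-/

/-! ### Signatures of real quadratic forms -/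

lemma ncard_neg_eq_sum {n : ℕ} (w : Fin n → ℝ) :
    {i | w i < 0}.ncard = ∑ i, if w i < 0 then 1 else 0 := by
  classical
  rw [Set.ncard_eq_toFinset_card', ← Finset.card_filter]
  congr 1
  ext i
  simp

open QuadraticMap in
/-- Adjoining a vector `η` of nonzero square `d`, orthogonal to a subspace `W` with `V = W + ℝ η`,
raises the dimension by one, and the negative index by one exactly if `d < 0`. -/
lemma finrank_sigNeg_of_orthogonal {V W : Type*} [AddCommGroup V] [Module ℝ V]
    [AddCommGroup W] [Module ℝ W] [FiniteDimensional ℝ V] [FiniteDimensional ℝ W]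
    {Q : QuadraticForm ℝ V} {Q' : QuadraticForm ℝ W} (i : W →ₗ[ℝ] V)
    (hi : Function.Injective i) (η : V) {d : ℝ} (hd : d ≠ 0)
    (hQ : ∀ (w : W) (t : ℝ), Q (i w + t • η) = Q' w + t ^ 2 * d)
    (hspan : ∀ v, ∃ (w : W) (t : ℝ), v = i w + t • η) :
    Module.finrank ℝ V = Module.finrank ℝ W + 1 ∧
    sigNeg Q = sigNeg Q' + (if d < 0 then 1 else 0) := by
  obtain ⟨n, w, ⟨e⟩⟩ : ∃ (n : ℕ) (w : Fin n → ℝ),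
      QuadraticMap.Equivalent Q' (weightedSumSquares ℝ w) :=
    ⟨_, QuadraticForm.equivalent_weightedSumSquares Q'⟩
  -- `η` is not in the image of `W`, as otherwise `Q' w₀ = d` and `Q' w₀ = -d`
  have hη : ∀ w₀, i w₀ ≠ η := by
    intro w₀ h
    have h1 := hQ (-w₀) 1
    have h2 := hQ w₀ 0
    have h3 := hQ 0 1
    simp only [map_neg, h, one_smul, neg_add_cancel, map_zero, QuadraticMap.map_neg, one_pow,
      one_mul, zero_smul, add_zero, zero_add, ne_eq, OfNat.ofNat_ne_zero, not_false_eq_true,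
      zero_pow, zero_mul] at h1 h2 h3
    exact hd (by linarith)
  have hinj : ∀ (w₀ : W) (t : ℝ), i w₀ + t • η = 0 → w₀ = 0 ∧ t = 0 := by
    intro w₀ t h
    by_cases ht : t = 0
    · subst ht
      rw [zero_smul, add_zero] at h
      exact ⟨hi (by rw [h, map_zero]), rfl⟩
    · refine (hη (-(t⁻¹ • w₀)) ?_).elim
      rw [map_neg, map_smul, eq_neg_of_add_eq_zero_left h, smul_neg, neg_neg, smul_smul,
        inv_mul_cancel₀ ht, one_smul]
  let g : (W × ℝ) →ₗ[ℝ] V := i.coprod (LinearMap.toSpanSingleton ℝ V η)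
  have hg : ∀ a t, g (a, t) = i a + t • η := fun a t => by simp [g]
  have hgb : Function.Bijective g := by
    constructor
    · rw [← LinearMap.ker_eq_bot, LinearMap.ker_eq_bot']
      rintro ⟨a, t⟩ h
      rw [hg] at h
      obtain ⟨rfl, rfl⟩ := hinj a t h
      rfl
    · intro v
      obtain ⟨a, t, rfl⟩ := hspan v
      exact ⟨(a, t), hg a t⟩
  let G := LinearEquiv.ofBijective g hgb
  have hdim : Module.finrank ℝ V = Module.finrank ℝ W + 1 := by
    rw [← G.finrank_eq, Module.finrank_prod, Module.finrank_self]
  refine ⟨hdim, ?_⟩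
  let f : (Fin (n + 1) → ℝ) ≃ₗ[ℝ] V :=
    (Fin.consLinearEquiv ℝ (fun _ => ℝ)).symm ≪≫ₗ (LinearEquiv.prodComm ℝ ℝ (Fin n → ℝ)) ≪≫ₗ
      (e.symm.toLinearEquiv.prodCongr (LinearEquiv.refl ℝ ℝ)) ≪≫ₗ G
  have hf : ∀ a, f a = i (e.symm (fun j => a j.succ)) + a 0 • η := fun a => hg _ _
  have hequiv : QuadraticMap.Equivalent Q
      (weightedSumSquares ℝ (Fin.cons d w : Fin (n + 1) → ℝ)) := by
    refine QuadraticMap.Equivalent.symm ⟨⟨f, fun a => ?_⟩⟩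
    change Q (f a) = _
    rw [hf, hQ, e.symm.map_app, weightedSumSquares_apply, weightedSumSquares_apply,
      Fin.sum_univ_succ]
    simp only [Fin.cons_zero, Fin.cons_succ, smul_eq_mul]
    ring
  have he : QuadraticMap.Equivalent Q' (weightedSumSquares ℝ w) := ⟨e⟩
  rw [QuadraticForm.sigNeg_of_equiv_weightedSumSquares hequiv,
    QuadraticForm.sigNeg_of_equiv_weightedSumSquares he, ncard_neg_eq_sum, ncard_neg_eq_sum,
    Fin.sum_univ_succ]
  simp [add_comm]

lemma neg_one_pow_ite_mul_pos {d : ℝ} (hd : d ≠ 0) :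
    0 < (-1 : ℝ) ^ (if d < 0 then 1 else 0) * d := by
  split_ifs with h
  · linarith
  · simpa using lt_of_le_of_ne (not_lt.mp h) hd.symm

open QuadraticMap in
/-- The companion of `finrank_sigNeg_of_orthogonal` for the positive index. -/
lemma sigPos_of_orthogonal {V W : Type*} [AddCommGroup V] [Module ℝ V]
    [AddCommGroup W] [Module ℝ W] [FiniteDimensional ℝ V] [FiniteDimensional ℝ W]
    {Q : QuadraticForm ℝ V} {Q' : QuadraticForm ℝ W} (i : W →ₗ[ℝ] V)
    (hi : Function.Injective i) (η : V) {d : ℝ} (hd : d ≠ 0)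
    (hQ : ∀ (w : W) (t : ℝ), Q (i w + t • η) = Q' w + t ^ 2 * d)
    (hspan : ∀ v, ∃ (w : W) (t : ℝ), v = i w + t • η) :
    sigPos Q = sigPos Q' + (if 0 < d then 1 else 0) := by
  have h := (finrank_sigNeg_of_orthogonal (Q := -Q) (Q' := -Q') i hi η (neg_ne_zero.mpr hd)
    (fun w t => by simp only [neg_apply, hQ]; ring) hspan).2
  simpa using h

/-- A quadratic form on a finite-dimensional space is nondegenerate: its positive and negative
indices exhaust the dimension. -/
def FullRank {V : Type*} [AddCommGroup V] [Module ℝ V] (Q : QuadraticForm ℝ V) : Prop :=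
  sigPos Q + sigNeg Q = Module.finrank ℝ V

lemma fullRank_iff_of_orthogonal {V W : Type*} [AddCommGroup V] [Module ℝ V]
    [AddCommGroup W] [Module ℝ W] [FiniteDimensional ℝ V] [FiniteDimensional ℝ W]
    {Q : QuadraticForm ℝ V} {Q' : QuadraticForm ℝ W} (i : W →ₗ[ℝ] V)
    (hi : Function.Injective i) (η : V) {d : ℝ} (hd : d ≠ 0)
    (hQ : ∀ (w : W) (t : ℝ), Q (i w + t • η) = Q' w + t ^ 2 * d)
    (hspan : ∀ v, ∃ (w : W) (t : ℝ), v = i w + t • η) :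
    FullRank Q ↔ FullRank Q' := by
  obtain ⟨h1, h2⟩ := finrank_sigNeg_of_orthogonal i hi η hd hQ hspan
  have h3 := sigPos_of_orthogonal i hi η hd hQ hspan
  unfold FullRank
  rcases lt_or_gt_of_ne hd with h | h
  · rw [if_pos h] at h2
    rw [if_neg h.not_gt] at h3
    omega
  · rw [if_neg h.not_gt] at h2
    rw [if_pos h] at h3
    omega

lemma sigPos_le_of_injective {V W : Type*} [AddCommGroup V] [Module ℝ V]
    [AddCommGroup W] [Module ℝ W] [FiniteDimensional ℝ V] [FiniteDimensional ℝ W]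
    {Q : QuadraticForm ℝ V} {Q' : QuadraticForm ℝ W} (i : W →ₗ[ℝ] V)
    (hi : Function.Injective i) (hQ : ∀ w, Q (i w) = Q' w) : sigPos Q' ≤ sigPos Q := by
  obtain ⟨U, hU, hpos⟩ := exists_finrank_eq_sigPos_and_posDef Q'
  rw [← hU, (Submodule.equivMapOfInjective i hi U).finrank_eq]
  apply le_sigPos_of_posDef
  rintro ⟨_, u, hu, rfl⟩ hne
  rw [QuadraticMap.restrict_apply, hQ]
  refine hpos ⟨u, hu⟩ fun h => hne ?_
  have h0 : u = 0 := congrArg Subtype.val h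
  ext
  simp [h0]

lemma sigNeg_le_of_injective {V W : Type*} [AddCommGroup V] [Module ℝ V]
    [AddCommGroup W] [Module ℝ W] [FiniteDimensional ℝ V] [FiniteDimensional ℝ W]
    {Q : QuadraticForm ℝ V} {Q' : QuadraticForm ℝ W} (i : W →ₗ[ℝ] V)
    (hi : Function.Injective i) (hQ : ∀ w, Q (i w) = Q' w) : sigNeg Q' ≤ sigNeg Q := by
  have h := sigPos_le_of_injective (Q := -Q) (Q' := -Q') i hi
    (fun w => by simp only [neg_apply, hQ])
  simpa using h

lemma toMatrix'_toQuadraticForm' {n : ℕ} {M : Matrix (Fin n) (Fin n) ℝ} (hM : M.IsSymm) :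
    QuadraticForm.toMatrix' M.toQuadraticForm' = M := by
  ext i j
  rw [QuadraticForm.toMatrix', LinearMap.toMatrix₂'_apply, Matrix.toQuadraticForm',
    QuadraticMap.associated_toQuadraticMap]
  simp only [Matrix.toLinearMap₂'_apply', Matrix.mulVec_single_one, single_one_dotProduct,
    Matrix.col_apply, hM.apply i j, Module.End.smul_def, ← two_mul]
  simp

open QuadraticMap in
/-- The sign of the determinant of a nondegenerate symmetric matrix is the parity of its negative
index. -/
lemma sign_det_eq_neg_one_pow_sigNeg {n : ℕ} {M : Matrix (Fin n) (Fin n) ℝ} (hM : M.IsSymm)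
    (hfull : FullRank M.toQuadraticForm') :
    SignType.sign M.det = (-1) ^ sigNeg M.toQuadraticForm' := by
  obtain ⟨w, e⟩ : ∃ w : Fin n → ℝ,
      Equivalent M.toQuadraticForm' (weightedSumSquares ℝ w) := by
    have := QuadraticForm.equivalent_weightedSumSquares M.toQuadraticForm'
    rwa [Module.finrank_fin_fun] at this
  have hneg := QuadraticForm.sigNeg_of_equiv_weightedSumSquares e
  have hpos := QuadraticForm.sigPos_of_equiv_weightedSumSquares e
  have hpos' : {i | 0 < w i}.ncard = ∑ i, if 0 < w i then 1 else 0 := by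
    simpa using ncard_neg_eq_sum (-w)
  rw [FullRank, hpos, hneg, ncard_neg_eq_sum, hpos', Module.finrank_fin_fun,
    ← Finset.sum_add_distrib] at hfull
  have hw : ∀ i, w i ≠ 0 := by
    intro i hi
    have hlt : ∑ j, ((if 0 < w j then 1 else 0) + (if w j < 0 then 1 else 0)) <
        ∑ _j : Fin n, 1 := by
      refine Finset.sum_lt_sum (fun j _ => ?_) ⟨i, Finset.mem_univ _, by simp [hi]⟩
      split_ifs with h1 h2 <;> first | omega | linarith
    simp [hfull] at hlt
  have hdiag : weightedSumSquares ℝ w = (Matrix.diagonal w).toQuadraticForm' := by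
    ext v
    rw [Matrix.toQuadraticForm', LinearMap.BilinMap.toQuadraticMap_apply,
      Matrix.toLinearMap₂'_apply', weightedSumSquares_apply]
    simp only [dotProduct, Matrix.mulVec_diagonal, smul_eq_mul]
    exact Finset.sum_congr rfl fun i _ => by ring
  obtain ⟨f⟩ := e
  set F : (Fin n → ℝ) →ₗ[ℝ] (Fin n → ℝ) := f.toLinearEquiv.toLinearMap with hFdef
  have h1 : M.toQuadraticForm' = (weightedSumSquares ℝ w).comp F := by
    ext v
    exact (f.map_app v).symm
  have hf : F.toMatrix'.det ≠ 0 := by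
    rw [LinearMap.det_toMatrix']
    exact (LinearEquiv.isUnit_det' f.toLinearEquiv).ne_zero
  clear_value F
  have hdet : M.det = F.toMatrix'.det * F.toMatrix'.det * ∏ i, w i := by
    have h2 := QuadraticForm.discr'_comp (Q := weightedSumSquares ℝ w) F
    rwa [← h1, QuadraticForm.discr', toMatrix'_toQuadraticForm' hM, QuadraticForm.discr', hdiag,
      toMatrix'_toQuadraticForm' (Matrix.isSymm_diagonal w), Matrix.det_diagonal] at h2
  rw [hdet, sign_mul, sign_pos (mul_self_pos.mpr hf), one_mul, hneg, ncard_neg_eq_sum,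
    ← Finset.prod_pow_eq_pow_sum, show SignType.sign (∏ i, w i) = signHom (∏ i, w i) from rfl, map_prod]
  refine Finset.prod_congr rfl fun i _ => ?_
  change SignType.sign (w i) = _
  rcases lt_or_gt_of_ne (hw i) with h | h
  · simp [h]
  · simp [h, h.not_gt]

/-! ### The area form on closed chains with prescribed edge directions -/

/-- The determinant `cross` as a bilinear map. -/
noncomputable def crossBilin : LinearMap.BilinForm ℝ Plane :=
  LinearMap.mk₂ ℝ cross
    (fun u v w => by simp only [cross, PiLp.add_apply]; ring)
    (fun c u v => by simp only [cross, PiLp.smul_apply, smul_eq_mul]; ring)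
    (fun u v w => by simp only [cross, PiLp.add_apply]; ring)
    (fun c u v => by simp only [cross, PiLp.smul_apply, smul_eq_mul]; ring)

lemma cross_self_eq_zero (u : Plane) : cross u u = 0 := by simp only [cross]; ring

lemma cross_swap (u v : Plane) : cross v u = -cross u v := by simp only [cross]; ring

lemma cross_add_left (u v w : Plane) : cross (u + v) w = cross u w + cross v w :=
  LinearMap.map_add₂ crossBilin u v w

lemma cross_add_right (u v w : Plane) : cross u (v + w) = cross u v + cross u w :=
  map_add (crossBilin u) v w

lemma cross_smul_left (c : ℝ) (u v : Plane) : cross (c • u) v = c * cross u v :=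
  LinearMap.map_smul₂ crossBilin c u v

lemma cross_smul_right (c : ℝ) (u v : Plane) : cross u (c • v) = c * cross u v :=
  map_smul (crossBilin u) c v

lemma cross_sum_left {ι : Type*} (s : Finset ι) (f : ι → Plane) (v : Plane) :
    cross (∑ i ∈ s, f i) v = ∑ i ∈ s, cross (f i) v :=
  LinearMap.map_sum₂ crossBilin s f v

lemma cross_sum_right {ι : Type*} (s : Finset ι) (f : ι → Plane) (u : Plane) :
    cross u (∑ i ∈ s, f i) = ∑ i ∈ s, cross u (f i) :=
  map_sum (crossBilin u) f s

lemma cross_zero_right (u : Plane) : cross u 0 = 0 := map_zero (crossBilin u)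

lemma cross_zero_left (u : Plane) : cross 0 u = 0 := by simp [cross]

/-- The linear relations between the vectors `x i`; equivalently, the closed polygonal chains whose
`i`-th edge is the multiple `τ i • x i` of `x i`. -/
def linearRelations {n : ℕ} (x : Fin n → Plane) : Submodule ℝ (Fin n → ℝ) where
  carrier := {τ | ∑ i, τ i • x i = 0}
  zero_mem' := by simp
  add_mem' := fun {a b} ha hb => by
    simp only [Set.mem_ofPred_eq] at ha hb ⊢
    simp only [Pi.add_apply, add_smul, Finset.sum_add_distrib, ha, hb, add_zero]
  smul_mem' := fun c a ha => by
    simp only [Set.mem_ofPred_eq] at ha ⊢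
    simp only [Pi.smul_apply, smul_eq_mul, mul_smul, ← Finset.smul_sum, ha, smul_zero]

lemma mem_linearRelations {n : ℕ} {x : Fin n → Plane} {τ : Fin n → ℝ} :
    τ ∈ linearRelations x ↔ ∑ i, τ i • x i = 0 := Iff.rfl

/-- The affine relations between the points `x i`. -/
def affineRelations {n : ℕ} (x : Fin n → Plane) : Submodule ℝ (Fin n → ℝ) where
  carrier := {τ | τ ∈ linearRelations x ∧ ∑ i, τ i = 0}
  zero_mem' := ⟨zero_mem _, by simp⟩
  add_mem' := fun {a b} ha hb => ⟨add_mem ha.1 hb.1, by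
    simp only [Pi.add_apply, Finset.sum_add_distrib, ha.2, hb.2, add_zero]⟩
  smul_mem' := fun c a ha => ⟨Submodule.smul_mem _ _ ha.1, by
    simp only [Pi.smul_apply, smul_eq_mul, ← Finset.mul_sum, ha.2, mul_zero]⟩

lemma mem_affineRelations {n : ℕ} {x : Fin n → Plane} {τ : Fin n → ℝ} :
    τ ∈ affineRelations x ↔ τ ∈ linearRelations x ∧ ∑ i, τ i = 0 := Iff.rfl

/-- The bilinear form whose value at `(τ, τ)` is twice the area of the polygonal chain with edges
`τ i • x i`, when this chain is closed. It is symmetric only on `linearRelations x`. -/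
noncomputable def chainBilin {n : ℕ} (x : Fin n → Plane) : LinearMap.BilinForm ℝ (Fin n → ℝ) :=
  LinearMap.mk₂ ℝ (fun σ τ => ∑ i, ∑ j, if j < i then σ j * τ i * cross (x j) (x i) else 0)
    (fun a b c => by
      simp only [← Finset.sum_add_distrib]
      refine Finset.sum_congr rfl fun i _ => Finset.sum_congr rfl fun j _ => ?_
      split_ifs
      · simp only [Pi.add_apply]; ring
      · simp)
    (fun c a b => by
      simp only [smul_eq_mul, Finset.mul_sum]
      refine Finset.sum_congr rfl fun i _ => Finset.sum_congr rfl fun j _ => ?_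
      split_ifs
      · simp only [Pi.smul_apply, smul_eq_mul]; ring
      · simp)
    (fun a b c => by
      simp only [← Finset.sum_add_distrib]
      refine Finset.sum_congr rfl fun i _ => Finset.sum_congr rfl fun j _ => ?_
      split_ifs
      · simp only [Pi.add_apply]; ring
      · simp)
    (fun c a b => by
      simp only [smul_eq_mul, Finset.mul_sum]
      refine Finset.sum_congr rfl fun i _ => Finset.sum_congr rfl fun j _ => ?_
      split_ifs
      · simp only [Pi.smul_apply, smul_eq_mul]; ring
      · simp)

lemma chainBilin_apply {n : ℕ} (x : Fin n → Plane) (σ τ : Fin n → ℝ) :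
    chainBilin x σ τ = ∑ i, ∑ j, if j < i then σ j * τ i * cross (x j) (x i) else 0 := rfl

/-- Twice the area of the closed polygonal chain with edges `τ i • x i`. -/
noncomputable def chainForm {n : ℕ} (x : Fin n → Plane) : QuadraticForm ℝ (Fin n → ℝ) :=
  (chainBilin x).toQuadraticMap

lemma chainForm_apply {n : ℕ} (x : Fin n → Plane) (τ : Fin n → ℝ) :
    chainForm x τ = chainBilin x τ τ := rfl

lemma chainForm_add_smul {n : ℕ} (x : Fin n → Plane) (τ η : Fin n → ℝ) (t : ℝ) :
    chainForm x (τ + t • η) =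
      chainForm x τ + t * (chainBilin x τ η + chainBilin x η τ) + t ^ 2 * chainForm x η := by
  simp only [chainForm_apply, map_add, map_smul, LinearMap.add_apply, LinearMap.smul_apply,
    smul_eq_mul]
  ring

lemma chainBilin_sub_swap {n : ℕ} (x : Fin n → Plane) (σ τ : Fin n → ℝ) :
    chainBilin x σ τ - chainBilin x τ σ = cross (∑ i, σ i • x i) (∑ i, τ i • x i) := by
  have h : cross (∑ i, σ i • x i) (∑ i, τ i • x i) =
      ∑ i, ∑ j, σ j * τ i * cross (x j) (x i) := by
    rw [cross_sum_right]
    refine Finset.sum_congr rfl fun i _ => ?_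
    rw [cross_sum_left]
    refine Finset.sum_congr rfl fun j _ => ?_
    rw [cross_smul_left, cross_smul_right, mul_assoc]
  rw [h, chainBilin_apply, chainBilin_apply, Finset.sum_comm (γ := Fin n) (f := fun i j =>
    if j < i then τ j * σ i * cross (x j) (x i) else 0), ← Finset.sum_sub_distrib]
  refine Finset.sum_congr rfl fun i _ => ?_
  rw [← Finset.sum_sub_distrib]
  refine Finset.sum_congr rfl fun j _ => ?_
  rcases lt_trichotomy i j with hij | rfl | hij
  · rw [if_neg hij.not_gt, if_pos hij, cross_swap (x i) (x j)]
    ring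
  · simp [cross_self_eq_zero]
  · rw [if_pos hij, if_neg hij.not_gt, sub_zero]

lemma chainBilin_comm {n : ℕ} {x : Fin n → Plane} {τ : Fin n → ℝ} (σ : Fin n → ℝ)
    (hτ : τ ∈ linearRelations x) : chainBilin x σ τ = chainBilin x τ σ := by
  have h := chainBilin_sub_swap x σ τ
  rw [mem_linearRelations.mp hτ, cross_zero_right] at h
  exact sub_eq_zero.mp h

/-- Summation by parts: `chainBilin x σ τ` in terms of the vertices `z i` of a closed chain with
edges `σ i • x i`. -/
lemma sum_cross_eq_chainBilin {N : ℕ} {x z : Fin (N + 1) → Plane} {σ τ : Fin (N + 1) → ℝ}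
    (hz : ∀ i, z (i + 1) = z i + σ (i + 1) • x (i + 1)) (hτ : τ ∈ linearRelations x) :
    ∑ i, τ i * cross (z i) (x i) = chainBilin x σ τ := by
  have hsum : ∀ i, z i = z (Fin.last N) + ∑ j, if j ≤ i then σ j • x j else 0 := by
    intro i
    induction i using Fin.induction with
    | zero =>
      have h := hz (Fin.last N)
      rw [Fin.last_add_one] at h
      rw [h, Finset.sum_eq_single 0 (fun j _ hj => if_neg (by simpa using hj)) (by simp),
        if_pos le_rfl]
    | succ i ih =>
      have h := hz i.castSucc
      rw [Fin.coeSucc_eq_succ] at h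
      rw [h, ih, add_assoc]
      congr 1
      have : ∀ j : Fin (N + 1), (if j ≤ i.succ then σ j • x j else 0) =
          (if j ≤ i.castSucc then σ j • x j else 0) +
            if j = i.succ then σ j • x j else 0 := by
        intro j
        rcases lt_trichotomy j i.succ with hj | rfl | hj
        · rw [if_pos hj.le, if_pos (Fin.le_castSucc_iff.mpr hj), if_neg hj.ne, add_zero]
        · rw [if_pos le_rfl, if_neg (by simp), if_pos rfl, zero_add]
        · rw [if_neg hj.not_ge, if_neg (fun h => hj.not_gt (Fin.le_castSucc_iff.mp h)),
            if_neg hj.ne', add_zero]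
      simp only [this, Finset.sum_add_distrib, Finset.sum_ite_eq', Finset.mem_univ, if_true]
  have h0 : ∑ i, τ i * cross (z (Fin.last N)) (x i) = 0 := by
    simp only [← cross_smul_right]
    rw [← cross_sum_right, mem_linearRelations.mp hτ, cross_zero_right]
  calc ∑ i, τ i * cross (z i) (x i)
      = ∑ i, (τ i * cross (z (Fin.last N)) (x i) +
          ∑ j, if j < i then σ j * τ i * cross (x j) (x i) else 0) := by
        refine Finset.sum_congr rfl fun i _ => ?_
        rw [hsum i, cross_add_left, mul_add, cross_sum_left, Finset.mul_sum]
        congr 1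
        refine Finset.sum_congr rfl fun j _ => ?_
        rcases lt_trichotomy j i with hj | rfl | hj
        · rw [if_pos hj.le, if_pos hj, cross_smul_left]
          ring
        · simp [cross_smul_left, cross_self_eq_zero]
        · rw [if_neg hj.not_ge, if_neg hj.not_gt, cross_zero_left, mul_zero]
    _ = chainBilin x σ τ := by
        rw [Finset.sum_add_distrib, h0, zero_add, chainBilin_apply]

lemma snoc_mem_linearRelations_iff {n : ℕ} {x : Fin (n + 1) → Plane} {τ : Fin n → ℝ} {t : ℝ} :
    (Fin.snoc τ t : Fin (n + 1) → ℝ) ∈ linearRelations x ↔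
      ∑ i, τ i • x i.castSucc = -(t • x (Fin.last n)) := by
  rw [mem_linearRelations, Fin.sum_univ_castSucc]
  simp only [Fin.snoc_castSucc, Fin.snoc_last]
  exact add_eq_zero_iff_eq_neg

lemma chainForm_snoc {n : ℕ} (x : Fin (n + 1) → Plane) (τ : Fin n → ℝ) (t : ℝ) :
    chainForm x (Fin.snoc τ t) = chainForm (fun i => x i.castSucc) τ +
      t * cross (∑ i, τ i • x i.castSucc) (x (Fin.last n)) := by
  rw [chainForm_apply, chainForm_apply, chainBilin_apply, chainBilin_apply,
    Fin.sum_univ_castSucc, cross_sum_left, Finset.mul_sum]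
  simp only [Fin.sum_univ_castSucc, Fin.snoc_castSucc, Fin.snoc_last, Fin.castSucc_lt_castSucc_iff,
    Fin.castSucc_lt_last, lt_irrefl, if_true, if_false, add_zero, cross_smul_left,
    (Fin.castSucc_lt_last _).not_gt]
  congr 1
  exact Finset.sum_congr rfl fun i _ => by ring

/-- Extension by zero of the linear relations between all vectors but the last one. -/
def linearRelationsSnoc {n : ℕ} (x : Fin (n + 1) → Plane) :
    linearRelations (fun i => x i.castSucc) →ₗ[ℝ] linearRelations x where
  toFun τ := ⟨Fin.snoc τ.1 0, by
    rw [snoc_mem_linearRelations_iff, zero_smul, neg_zero]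
    exact τ.2⟩
  map_add' a b := by
    ext i
    refine Fin.lastCases ?_ (fun i => ?_) i <;> simp
  map_smul' c a := by
    ext i
    refine Fin.lastCases ?_ (fun i => ?_) i <;> simp

/-- Extension by zero of the affine relations between all points but the last one. -/
def affineRelationsSnoc {n : ℕ} (x : Fin (n + 1) → Plane) :
    affineRelations (fun i => x i.castSucc) →ₗ[ℝ] affineRelations x where
  toFun τ := ⟨Fin.snoc τ.1 0, by
    rw [mem_affineRelations, snoc_mem_linearRelations_iff, zero_smul, neg_zero]
    exact ⟨τ.2.1, by simpa [Fin.sum_univ_castSucc] using τ.2.2⟩⟩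
  map_add' a b := by
    ext i
    refine Fin.lastCases ?_ (fun i => ?_) i <;> simp
  map_smul' c a := by
    ext i
    refine Fin.lastCases ?_ (fun i => ?_) i <;> simp

lemma affineRelationsSnoc_injective {n : ℕ} (x : Fin (n + 1) → Plane) :
    Function.Injective (affineRelationsSnoc x) := by
  intro a b h
  ext i
  simpa [affineRelationsSnoc] using congrFun (congrArg Subtype.val h) i.castSucc

lemma linearRelationsSnoc_injective {n : ℕ} (x : Fin (n + 1) → Plane) :
    Function.Injective (linearRelationsSnoc x) := by
  intro a b h
  ext i
  simpa [linearRelationsSnoc] using congrFun (congrArg Subtype.val h) i.castSucc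

/-! ### Signature of the area form on closed chains -/

/-- The area form on the closed chains with edge directions `x i`. -/
noncomputable def linearForm {n : ℕ} (x : Fin n → Plane) : QuadraticForm ℝ (linearRelations x) :=
  (chainForm x).restrict (linearRelations x)

/-- The area form on the affine relations between the points `x i`. -/
noncomputable def affineForm {n : ℕ} (x : Fin n → Plane) : QuadraticForm ℝ (affineRelations x) :=
  (chainForm x).restrict (affineRelations x)

lemma linearForm_apply {n : ℕ} (x : Fin n → Plane) (τ : linearRelations x) :
    linearForm x τ = chainForm x τ := rfl

lemma affineForm_apply {n : ℕ} (x : Fin n → Plane) (τ : affineRelations x) :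
    affineForm x τ = chainForm x τ := rfl

lemma affineForm_snoc {n : ℕ} (x : Fin (n + 1) → Plane)
    (τ : affineRelations (fun i => x i.castSucc)) :
    affineForm x (affineRelationsSnoc x τ) = affineForm _ τ := by
  rw [affineForm_apply, affineForm_apply]
  change chainForm x (Fin.snoc τ.1 0) = _
  rw [chainForm_snoc, zero_mul, add_zero]

lemma chainBilin_single_zero {n : ℕ} {x : Fin (n + 1) → Plane} (a : ℝ) (τ : Fin (n + 1) → ℝ) :
    chainBilin x (Pi.single 0 a) τ = a * cross (x 0) (∑ i, τ i • x i) := by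
  rw [chainBilin_apply, cross_sum_right, Finset.mul_sum]
  refine Finset.sum_congr rfl fun i _ => ?_
  rw [Finset.sum_eq_single 0 (fun j _ hj => by simp [hj]) (by simp), cross_smul_right]
  split_ifs with h
  · rw [Pi.single_eq_same]; ring
  · obtain rfl : i = 0 := by simpa using h
    simp [cross_self_eq_zero]

lemma chainBilin_single_last {n : ℕ} {x : Fin (n + 1) → Plane} (b : ℝ) (τ : Fin (n + 1) → ℝ) :
    chainBilin x (Pi.single (Fin.last n) b) τ = 0 := by
  rw [chainBilin_apply]
  refine Finset.sum_eq_zero fun i _ => Finset.sum_eq_zero fun j _ => ?_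
  split_ifs with h
  · rw [Pi.single_eq_of_ne (ne_of_lt (h.trans_le (Fin.le_last i)))]; ring
  · rfl

lemma cross_smul_add_cyclic (u v w : Plane) :
    cross v w • u + cross w u • v = -(cross u v • w) := by
  ext i
  fin_cases i <;> simp [cross] <;> ring

/-- The triangle with edges along `x 0` and the last two of the vectors `x i` is orthogonal to the
chains that do not use the last vector. -/
lemma linearForm_split {k : ℕ} (x : Fin (k + 3) → Plane)
    (hc : cross (x 0) (x (Fin.last (k + 1)).castSucc) ≠ 0) :
    ∃ η : linearRelations x,
      (∀ (w : linearRelations fun i => x i.castSucc) (t : ℝ),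
        linearForm x (linearRelationsSnoc x w + t • η) = linearForm _ w +
          t ^ 2 * (cross (x (Fin.last (k + 1)).castSucc) (x (Fin.last (k + 2))) *
            cross (x (Fin.last (k + 2))) (x 0) *
            cross (x 0) (x (Fin.last (k + 1)).castSucc))) ∧
      ∀ v, ∃ (w : linearRelations fun i => x i.castSucc) (t : ℝ),
        v = linearRelationsSnoc x w + t • η := by
  set y := x (Fin.last (k + 1)).castSucc with hy
  set z := x (Fin.last (k + 2)) with hz
  set x' : Fin (k + 2) → Plane := fun i => x i.castSucc with hx'
  set η' : Fin (k + 2) → ℝ :=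
    Pi.single 0 (cross y z) + Pi.single (Fin.last (k + 1)) (cross z (x 0)) with hη'
  have hsum : ∑ i, η' i • x i.castSucc = cross y z • x 0 + cross z (x 0) • y := by
    simp only [hη', Pi.add_apply, add_smul, Finset.sum_add_distrib]
    rw [Finset.sum_eq_single 0 (fun j _ hj => by simp [hj]) (by simp),
      Finset.sum_eq_single (Fin.last (k + 1)) (fun j _ hj => by simp [hj]) (by simp)]
    simp [hy]
  have hη : (Fin.snoc η' (cross (x 0) y) : Fin (k + 3) → ℝ) ∈ linearRelations x := by
    rw [snoc_mem_linearRelations_iff, hsum, cross_smul_add_cyclic]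
  have hB : ∀ τ : Fin (k + 2) → ℝ,
      chainBilin x' η' τ = cross y z * cross (x 0) (∑ i, τ i • x' i) := by
    intro τ
    rw [hη', map_add, LinearMap.add_apply, chainBilin_single_zero, chainBilin_single_last,
      add_zero]
    rfl
  have hD : chainForm x' η' = cross y z * cross z (x 0) * cross (x 0) y := by
    rw [chainForm_apply, hB]
    change _ * cross (x 0) (∑ i, η' i • x i.castSucc) = _
    rw [hsum, cross_add_right,
      cross_smul_right, cross_smul_right, cross_self_eq_zero]
    ring
  refine ⟨⟨_, hη⟩, fun w t => ?_, fun v => ?_⟩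
  · have hvec : (linearRelationsSnoc x w + t • (⟨_, hη⟩ : linearRelations x) :
        linearRelations x).1 = Fin.snoc (w.1 + t • η') (t * cross (x 0) y) := by
      ext i
      refine Fin.lastCases ?_ (fun i => ?_) i <;> simp [linearRelationsSnoc]
    have hw : ∑ i, (w.1 + t • η') i • x i.castSucc = (-t * cross (x 0) y) • z := by
      have := mem_linearRelations.mp w.2
      simp only [Pi.add_apply, Pi.smul_apply, smul_eq_mul, add_smul, mul_smul,
        Finset.sum_add_distrib, ← Finset.smul_sum]
      rw [this, hsum, cross_smul_add_cyclic, zero_add, smul_neg, neg_smul, hz]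
    rw [linearForm_apply, linearForm_apply, hvec, chainForm_snoc, hw, cross_smul_left,
      cross_self_eq_zero, mul_zero, mul_zero, add_zero, chainForm_add_smul, hD,
      chainBilin_comm η' w.2, ← chainBilin_comm η' w.2, hB, mem_linearRelations.mp w.2,
      cross_zero_right, mul_zero, add_zero, mul_zero, add_zero]
  · set t := v.1 (Fin.last _) / cross (x 0) y with ht
    set u := v.1 - t • (Fin.snoc η' (cross (x 0) y) : Fin (k + 3) → ℝ) with hu
    have hu0 : u (Fin.last _) = 0 := by
      simp only [hu, Pi.sub_apply, Pi.smul_apply, Fin.snoc_last, smul_eq_mul]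
      rw [ht, div_mul_cancel₀ _ hc, sub_self]
    have husn : u = Fin.snoc (Fin.init u) 0 := by
      rw [← hu0, Fin.snoc_init_self]
    have humem : (Fin.snoc (Fin.init u) 0 : Fin (k + 3) → ℝ) ∈ linearRelations x := by
      rw [← husn]
      exact sub_mem v.2 (Submodule.smul_mem _ _ hη)
    refine ⟨⟨Fin.init u, ?_⟩, t, ?_⟩
    · rw [snoc_mem_linearRelations_iff, zero_smul, neg_zero] at humem
      exact humem
    · ext1
      change v.1 = Fin.snoc (Fin.init u) 0 + t • (Fin.snoc η' (cross (x 0) y) : Fin (k + 3) → ℝ)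
      rw [← husn, hu, sub_add_cancel]

/-- The area form on the closed chains with `k + 2` edge directions, each not parallel to the first
and to the next one, is nondegenerate, and the parity of its negative index is determined by the
orientations of the pairs of consecutive directions. -/
lemma linearForm_signature (k : ℕ) (x : Fin (k + 2) → Plane)
    (h0 : ∀ i, i ≠ 0 → cross (x 0) (x i) ≠ 0)
    (hc : ∀ i : Fin (k + 1), cross (x i.castSucc) (x i.succ) ≠ 0) :
    Module.finrank ℝ (linearRelations x) = k ∧ FullRank (linearForm x) ∧
    0 < (-1) ^ sigNeg (linearForm x) * ((-1) ^ (k + 1) *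
      ((∏ i : Fin (k + 1), cross (x i.castSucc) (x i.succ)) * cross (x (Fin.last _)) (x 0))) := by
  induction k with
  | zero =>
    have hbot : ∀ τ : linearRelations x, τ = 0 := by
      rintro ⟨τ, hτ⟩
      rw [mem_linearRelations, Fin.sum_univ_two] at hτ
      have h1 := congrArg (cross (x 0)) hτ
      have h2 := congrArg (fun u => cross u (x 1)) hτ
      rw [cross_add_right, cross_smul_right,
        cross_smul_right, cross_self_eq_zero, cross_zero_right] at h1
      simp only [cross_add_left, cross_smul_left, cross_self_eq_zero, cross_zero_left] at h2
      have h01 := h0 1 (by simp)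
      ext i
      fin_cases i
      · simpa [h01] using h2
      · simpa [h01] using h1
    have hsub : Subsingleton (linearRelations x) := ⟨fun a b => by rw [hbot a, hbot b]⟩
    have hdim : Module.finrank ℝ (linearRelations x) = 0 := Module.finrank_zero_of_subsingleton
    have hp : sigPos (linearForm x) = 0 := by
      have := sigPos_le_finrank (linearForm x); omega
    have hn : sigNeg (linearForm x) = 0 := by
      rw [← sigPos_neg]
      have := sigPos_le_finrank (-linearForm x); omega
    refine ⟨hdim, by rw [FullRank, hp, hn, hdim], ?_⟩
    have h01 : cross (x 0) (x 1) ≠ 0 := h0 1 (by simp)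
    rw [hn]
    simp only [Fin.prod_univ_castSucc, Fin.prod_univ_zero, pow_zero, zero_add, pow_one, one_mul]
    change 0 < -1 * (cross (x 0) (x 1) * cross (x 1) (x 0))
    rw [cross_swap (x 0) (x 1)]
    have := mul_self_pos.mpr h01
    linarith
  | succ k ih =>
    obtain ⟨ih1, ih2, ih3⟩ := ih (fun i => x i.castSucc)
      (fun i hi => h0 i.castSucc (fun h => hi (by simpa using h)))
      (fun i => by simpa only [Fin.succ_castSucc] using hc i.castSucc)
    have hne1 : cross (x 0) (x (Fin.last (k + 1)).castSucc) ≠ 0 := h0 _ (by simp [Fin.ext_iff])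
    have hne2 : cross (x (Fin.last (k + 2))) (x 0) ≠ 0 := by
      rw [cross_swap]
      exact neg_ne_zero.mpr (h0 _ (by simp [Fin.ext_iff]))
    have hne3 : cross (x (Fin.last (k + 1)).castSucc) (x (Fin.last (k + 2))) ≠ 0 :=
      hc (Fin.last (k + 1))
    obtain ⟨η, hQ, hspan⟩ := linearForm_split x hne1
    have hd := mul_ne_zero (mul_ne_zero hne3 hne2) hne1
    obtain ⟨h1, h2⟩ := finrank_sigNeg_of_orthogonal _ (linearRelationsSnoc_injective x) η hd hQ hspan
    refine ⟨by rw [h1, ih1], (fullRank_iff_of_orthogonal _ (linearRelationsSnoc_injective x) η hd hQ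
      hspan).mpr ih2, ?_⟩
    have hpos := mul_pos ih3 (neg_one_pow_ite_mul_pos hd)
    rw [h2, Fin.prod_univ_castSucc, pow_add, pow_succ _ (k + 1)]
    simp only [Fin.succ_castSucc, Fin.succ_last]
    simp only [Fin.castSucc_zero] at hpos
    rw [cross_swap (x 0)] at hpos
    have hsq := mul_self_pos.mpr hne1
    refine pos_of_mul_pos_left (b := cross (x 0) (x (Fin.last (k + 1)).castSucc) *
      cross (x 0) (x (Fin.last (k + 1)).castSucc)) ?_ hsq.le
    refine lt_of_lt_of_eq hpos ?_
    ring

/-! ### Restriction to affine relations between points of a circle -/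

/-- The rotation of the plane by a right angle to the left. -/
def rot (v : Plane) : Plane := !₂[-v 1, v 0]

@[simp] lemma rot_apply_zero (v : Plane) : rot v 0 = -v 1 := rfl

@[simp] lemma rot_apply_one (v : Plane) : rot v 1 = v 0 := rfl

lemma inner_plane (u v : Plane) : inner ℝ u v = u 0 * v 0 + u 1 * v 1 := by
  simp [PiLp.inner_apply, Fin.sum_univ_two, mul_comm]

/-- The tangent of half the signed angle from `u` to `v`, for two vectors of the same length. -/
noncomputable def tanHalf (u v : Plane) : ℝ := cross u v / (‖u‖ ^ 2 + inner ℝ u v)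

lemma cross_sq_add_inner_sq (u v : Plane) :
    cross u v ^ 2 + inner ℝ u v ^ 2 = ‖u‖ ^ 2 * ‖v‖ ^ 2 := by
  rw [← real_inner_self_eq_norm_sq u, ← real_inner_self_eq_norm_sq v]
  simp only [inner_plane, cross]
  ring

lemma norm_sq_add_inner_pos {u v : Plane} (h : ‖v‖ = ‖u‖) (hc : cross u v ≠ 0) :
    0 < ‖u‖ ^ 2 + inner ℝ u v := by
  have h1 := cross_sq_add_inner_sq u v
  rw [h] at h1
  have h2 : 0 < cross u v ^ 2 := by positivity
  nlinarith [sq_nonneg (‖u‖ ^ 2 + inner ℝ u v), sq_nonneg ‖u‖]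

lemma tanHalf_smul_add {u v : Plane} (h : ‖v‖ = ‖u‖) (hc : cross u v ≠ 0) :
    tanHalf u v • (u + v) = rot u - rot v := by
  have hpos := (norm_sq_add_inner_pos h hc).ne'
  have h1 : ‖u‖ ^ 2 = u 0 * u 0 + u 1 * u 1 := by
    rw [← real_inner_self_eq_norm_sq, inner_plane]
  have h2 : ‖u‖ ^ 2 = v 0 * v 0 + v 1 * v 1 := by
    rw [← h, ← real_inner_self_eq_norm_sq, inner_plane]
  have key : cross u v • (u + v) = (‖u‖ ^ 2 + inner ℝ u v) • (rot u - rot v) := by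
    ext i
    fin_cases i
    · simp only [cross, inner_plane, Fin.zero_eta, PiLp.smul_apply, PiLp.add_apply, PiLp.sub_apply,
        rot_apply_zero, smul_eq_mul]
      linear_combination (-v 1) * h1 + (u 1) * h2
    · simp only [cross, inner_plane, Fin.mk_one, PiLp.smul_apply, PiLp.add_apply, PiLp.sub_apply,
        rot_apply_one, smul_eq_mul]
      linear_combination (v 0) * h1 - (u 0) * h2
  rw [tanHalf, div_eq_inv_mul, mul_smul, key, smul_smul, inv_mul_cancel₀ hpos, one_smul]

lemma cross_neg_rot_self (u : Plane) : cross (-rot u) u = ‖u‖ ^ 2 := by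
  rw [← real_inner_self_eq_norm_sq, inner_plane]
  simp [cross]
  ring

lemma affineRelations_le {n : ℕ} (x : Fin n → Plane) : affineRelations x ≤ linearRelations x :=
  fun _ h => h.1

/-- The polygon formed by the tangent lines to the circle at the points `x i` represents the sum
functional `τ ↦ ∑ τ i` on the closed chains, up to the factor `r ^ 2`. -/
lemma exists_tangential_polygon {N : ℕ} {x : Fin (N + 1) → Plane} {r : ℝ}
    (hr : ∀ i, ‖x i‖ = r) (hc : ∀ i, cross (x i) (x (i + 1)) ≠ 0) :
    ∃ η ∈ linearRelations x, ∑ i, η i = 2 * ∑ i, tanHalf (x i) (x (i + 1)) ∧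
      ∀ τ ∈ linearRelations x, chainBilin x η τ = r ^ 2 * ∑ i, τ i := by
  set a : Fin (N + 1) → ℝ := fun i => tanHalf (x i) (x (i + 1)) with ha
  -- `rot (z i)` is the intersection of the tangent lines at `x i` and `x (i + 1)`
  set z : Fin (N + 1) → Plane := fun i => -rot (x i) + a i • x i with hz
  set η : Fin (N + 1) → ℝ := fun i => a (i - 1) + a i with hη
  have hstep : ∀ i, z (i + 1) = z i + η (i + 1) • x (i + 1) := by
    intro i
    have h := tanHalf_smul_add (by rw [hr, hr]) (hc i)
    simp only [hz, hη, add_sub_cancel_right]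
    rw [smul_add] at h
    rw [add_smul, ← sub_eq_zero]
    change tanHalf (x i) (x (i + 1)) • x i + a i • x (i + 1) = _ at h
    rw [show tanHalf (x i) (x (i + 1)) = a i from rfl] at h
    calc _ = (rot (x i) - rot (x (i + 1))) - (a i • x i + a i • x (i + 1)) := by abel
      _ = 0 := by rw [h, sub_self]
  have hsum : ∀ f : Fin (N + 1) → ℝ, ∑ i, f (i - 1) = ∑ i, f i :=
    fun f => Equiv.sum_comp (Equiv.subRight 1) f
  refine ⟨η, ?_, ?_, fun τ hτ => ?_⟩
  · rw [mem_linearRelations, ← Equiv.sum_comp (Equiv.addRight 1)]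
    have h1 : ∀ i, η (i + 1) • x (i + 1) = z (i + 1) - z i := fun i => by rw [hstep]; abel
    simp only [Equiv.coe_addRight, h1, Finset.sum_sub_distrib]
    exact sub_eq_zero.mpr (Equiv.sum_comp (Equiv.addRight 1) z)
  · rw [hη, Finset.sum_add_distrib, hsum]
    ring
  · rw [← sum_cross_eq_chainBilin hstep hτ, Finset.mul_sum]
    refine Finset.sum_congr rfl fun i _ => ?_
    rw [hz, cross_add_left, cross_smul_left, cross_self_eq_zero, cross_neg_rot_self, hr]
    ring

/-- The tangential polygon spans an orthogonal complement of the affine relations in the space of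
closed chains. -/
lemma linearForm_split_affine {N : ℕ} {x : Fin (N + 1) → Plane} {r : ℝ}
    (hr : ∀ i, ‖x i‖ = r) (hc : ∀ i, cross (x i) (x (i + 1)) ≠ 0)
    (hδ : ∑ i, tanHalf (x i) (x (i + 1)) ≠ 0) :
    ∃ η : linearRelations x,
      (∀ (w : affineRelations x) (t : ℝ),
        linearForm x (Submodule.inclusion (affineRelations_le x) w + t • η) = affineForm x w +
          t ^ 2 * (r ^ 2 * (2 * ∑ i, tanHalf (x i) (x (i + 1))))) ∧
      ∀ v, ∃ (w : affineRelations x) (t : ℝ),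
        v = Submodule.inclusion (affineRelations_le x) w + t • η := by
  obtain ⟨η, hη, hsum, hB⟩ := exists_tangential_polygon hr hc
  refine ⟨⟨η, hη⟩, fun w t => ?_, fun v => ?_⟩
  · change chainForm x (w.1 + t • η) = chainForm x w.1 + _
    rw [chainForm_add_smul, chainBilin_comm _ hη, hB _ w.2.1, w.2.2, chainForm_apply x η,
      hB _ hη, hsum]
    ring
  · have hs : ∑ i, η i ≠ 0 := by rw [hsum]; exact mul_ne_zero two_ne_zero hδ
    set t := (∑ i, v.1 i) / ∑ i, η i with ht
    refine ⟨⟨v.1 - t • η, sub_mem v.2 (Submodule.smul_mem _ _ hη), ?_⟩, t, ?_⟩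
    · simp only [Pi.sub_apply, Pi.smul_apply, smul_eq_mul, Finset.sum_sub_distrib, ← Finset.mul_sum]
      rw [ht, div_mul_cancel₀ _ hs, sub_self]
    · ext1
      change v.1 = v.1 - t • η + t • η
      rw [sub_add_cancel]

/-- Under the genericity conditions, the area form on the affine relations between `m + 3` points of
a circle centred at the origin is nondegenerate, and the parity of its negative index is given by
`δ` and the orientations of the edges. -/
lemma affineForm_signature {m : ℕ} {x : Fin (m + 3) → Plane} {r : ℝ}
    (hr : ∀ i, ‖x i‖ = r) (hc : ∀ i, cross (x i) (x (i + 1)) ≠ 0)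
    (h0 : ∀ i, i ≠ 0 → cross (x 0) (x i) ≠ 0)
    (hδ : ∑ i, tanHalf (x i) (x (i + 1)) ≠ 0) :
    Module.finrank ℝ (affineRelations x) = m ∧ FullRank (affineForm x) ∧
    0 < (-1) ^ sigNeg (affineForm x) * ((∑ i, tanHalf (x i) (x (i + 1))) *
      ((-1) ^ m * ∏ i, cross (x i) (x (i + 1)))) := by
  have hr0 : 0 < r := by
    rcases (norm_nonneg (x 0)).eq_or_lt with h | h
    · refine absurd ?_ (hc 0)
      rw [norm_eq_zero.mp h.symm, cross_zero_left]
    · rwa [hr] at h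
  obtain ⟨h1, h2, h3⟩ := linearForm_signature (m + 1) x h0
    (fun i => by simpa only [Fin.coeSucc_eq_succ] using hc i.castSucc)
  obtain ⟨η, hQ, hspan⟩ := linearForm_split_affine hr hc hδ
  have hinj : Function.Injective (Submodule.inclusion (affineRelations_le x)) :=
    Submodule.inclusion_injective _
  have hd : r ^ 2 * (2 * ∑ i, tanHalf (x i) (x (i + 1))) ≠ 0 :=
    mul_ne_zero (pow_ne_zero 2 hr0.ne') (mul_ne_zero two_ne_zero hδ)
  obtain ⟨h4, h5⟩ := finrank_sigNeg_of_orthogonal _ hinj η hd hQ hspan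
  refine ⟨Nat.succ_injective (h4.symm.trans h1), (fullRank_iff_of_orthogonal _ hinj η hd hQ hspan).mp h2, ?_⟩
  have hprod : ∏ i, cross (x i) (x (i + 1)) =
      (∏ i : Fin (m + 2), cross (x i.castSucc) (x i.succ)) * cross (x (Fin.last _)) (x 0) := by
    rw [Fin.prod_univ_castSucc, Fin.last_add_one]
    simp only [Fin.coeSucc_eq_succ]
  rw [h5, ← hprod, pow_add] at h3
  have h6 := mul_pos h3 (neg_one_pow_ite_mul_pos hd)
  set ε : ℝ := (-1) ^ (if r ^ 2 * (2 * ∑ i, tanHalf (x i) (x (i + 1))) < 0 then 1 else 0) with hε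
  have hεε : ε * ε = 1 := by
    rw [hε]
    split_ifs <;> norm_num
  refine pos_of_mul_pos_left (b := 2 * r ^ 2) ?_ (by positivity)
  refine lt_of_lt_of_eq h6 ?_
  rw [pow_add _ m 2]
  linear_combination ((-1) ^ sigNeg (affineForm x) * (∑ i, tanHalf (x i) (x (i + 1))) *
      ((-1) ^ m * ∏ i, cross (x i) (x (i + 1))) * (2 * r ^ 2)) * hεε

/-! ### Genericity and orientations of cyclic polygons -/

lemma tan_angle_div_two {u v : Plane} (h : ‖v‖ = ‖u‖) (hc : cross u v ≠ 0) :
    Real.tan (InnerProductGeometry.angle u v / 2) = |cross u v| / (‖u‖ ^ 2 + inner ℝ u v) := by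
  set θ := InnerProductGeometry.angle u v with hθ
  have hpos := norm_sq_add_inner_pos h hc
  have hcos : Real.cos θ * (‖u‖ * ‖v‖) = inner ℝ u v :=
    InnerProductGeometry.cos_angle_mul_norm_mul_norm u v
  have hsin : Real.sin θ * (‖u‖ * ‖v‖) = |cross u v| := by
    rw [hθ, InnerProductGeometry.sin_angle_mul_norm_mul_norm, ← Real.sqrt_sq_eq_abs]
    congr 1
    have := cross_sq_add_inner_sq u v
    rw [real_inner_self_eq_norm_sq, real_inner_self_eq_norm_sq]
    linarith
  have h2 : θ = 2 * (θ / 2) := by ring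
  rw [h2, Real.cos_two_mul, h] at hcos
  rw [h2, Real.sin_two_mul, h] at hsin
  have hc2 : Real.cos (θ / 2) ≠ 0 := by
    intro h0
    rw [h0] at hcos
    nlinarith
  rw [Real.tan_eq_sin_div_cos, div_eq_div_iff hc2 hpos.ne', ← hsin, ← hcos]
  ring

lemma cross_ne_zero_of_norm_eq {u v : Plane} (h : ‖v‖ = ‖u‖) (h1 : v ≠ u) (h2 : v ≠ -u) :
    cross u v ≠ 0 := by
  intro hc
  have hsq := cross_sq_add_inner_sq u v
  rw [hc, h] at hsq
  have hprod : (inner ℝ u v - ‖u‖ ^ 2) * (inner ℝ u v + ‖u‖ ^ 2) = 0 := by linarith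
  rcases mul_eq_zero.mp hprod with h3 | h3
  · refine h1 (sub_eq_zero.mp (norm_eq_zero.mp (pow_eq_zero_iff two_ne_zero |>.mp ?_)))
    rw [norm_sub_sq_real, real_inner_comm, h]
    linarith
  · refine h2 (add_eq_zero_iff_eq_neg.mp (norm_eq_zero.mp (pow_eq_zero_iff two_ne_zero |>.mp ?_)))
    rw [norm_add_sq_real, real_inner_comm, h]
    linarith

namespace PlanarPolygon

variable {m : ℕ} {q : PlanarPolygon m} {O : Plane} {r : ℝ}

lemma norm_vertex_sub (h : q.InscribedIn O r) (i : Fin (m + 3)) : ‖q i - O‖ = r := by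
  rw [← dist_eq_norm, h]

lemma cross_vertex_ne_zero (h : q.InscribedIn O r) (he : ∀ i, q i ≠ q (i + 1))
    (hcent : ¬ q.IsCentral O) (i : Fin (m + 3)) : cross (q i - O) (q (i + 1) - O) ≠ 0 := by
  refine cross_ne_zero_of_norm_eq (by rw [norm_vertex_sub h, norm_vertex_sub h]) (fun h1 => ?_)
    (fun h2 => ?_)
  · exact he i (sub_left_injective h1).symm
  · refine hcent ⟨i, 1 / 2, 1 / 2, by norm_num, by norm_num, by norm_num, ?_⟩
    rw [← smul_add, sub_eq_iff_eq_add.mp h2]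
    module

lemma orientation_eq (i : Fin (m + 3)) : q.orientation O i =
    if 0 < cross (q i - O) (q (i + 1) - O) then 1 else -1 := by
  have : cross (q (i + 1) - q i) (O - q i) = cross (q i - O) (q (i + 1) - O) := by
    simp only [cross, PiLp.sub_apply]
    ring
  rw [orientation, this]

lemma orientation_mul_tan_halfAngle (h : q.InscribedIn O r) (i : Fin (m + 3))
    (hc : cross (q i - O) (q (i + 1) - O) ≠ 0) :
    q.orientation O i * Real.tan (q.halfAngle O i) = tanHalf (q i - O) (q (i + 1) - O) := by
  rw [halfAngle, tan_angle_div_two (by rw [norm_vertex_sub h, norm_vertex_sub h]) hc,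
    orientation_eq, tanHalf]
  split_ifs with h1
  · rw [abs_of_pos h1, one_mul]
  · rw [abs_of_nonpos (not_lt.mp h1)]
    ring

lemma sign_prod_cross (hc : ∀ i, cross (q i - O) (q (i + 1) - O) ≠ 0) :
    SignType.sign (∏ i, cross (q i - O) (q (i + 1) - O)) =
      (-1) ^ (m + 3) * (-1) ^ q.numPositive O := by
  classical
  have h1 : ∀ i, SignType.sign (cross (q i - O) (q (i + 1) - O)) =
      if q.orientation O i = 1 then 1 else -1 := by
    intro i
    rw [orientation_eq]
    rcases lt_or_gt_of_ne (hc i) with h | h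
    · rw [if_neg h.not_gt, if_neg (by norm_num), sign_neg h]
    · rw [if_pos h, if_pos rfl, sign_pos h]
  have h2 : (Finset.univ.filter fun i => ¬ q.orientation O i = 1).card + q.numPositive O =
      m + 3 := by
    have := Finset.card_filter_add_card_filter_not (s := (Finset.univ : Finset (Fin (m + 3))))
      (fun i => q.orientation O i = 1)
    rw [Finset.card_univ, Fintype.card_fin, add_comm] at this
    convert this using 2
    unfold numPositive
    congr
  rw [show SignType.sign (∏ i, cross (q i - O) (q (i + 1) - O)) =
    signHom (∏ i, cross (q i - O) (q (i + 1) - O)) from rfl, map_prod]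
  change ∏ i, SignType.sign (cross (q i - O) (q (i + 1) - O)) = _
  simp only [h1]
  have h3 := congrArg (fun k : ℕ => (-1 : SignType) ^ k) h2
  simp only [pow_add] at h3
  rw [Finset.prod_ite, Finset.prod_const_one, one_mul, Finset.prod_const, pow_add, ← h3, mul_assoc,
    ← mul_pow]
  simp

/-- The signature of the area form attached to a generic cyclic polygon. -/
lemma affineForm_signature (h : q.InscribedIn O r) (he : ∀ i, q i ≠ q (i + 1))
    (hcent : ¬ q.IsCentral O) (h0 : ∀ i, i ≠ 0 → cross (q 0 - O) (q i - O) ≠ 0)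
    (hδ : q.delta O ≠ 0) :
    Module.finrank ℝ (affineRelations fun i => q i - O) = m ∧
    FullRank (affineForm fun i => q i - O) ∧
    (-1 : SignType) ^ sigNeg (affineForm fun i => q i - O) =
      -SignType.sign (q.delta O) * (-1) ^ q.numPositive O := by
  have hc := cross_vertex_ne_zero h he hcent
  have hdelta : q.delta O = ∑ i, tanHalf (q i - O) (q (i + 1) - O) :=
    Finset.sum_congr rfl fun i _ => orientation_mul_tan_halfAngle h i (hc i)
  obtain ⟨h1, h2, h3⟩ := _root_.affineForm_signature (x := fun i => q i - O) (norm_vertex_sub h) hc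
    h0 (by rwa [← hdelta])
  refine ⟨h1, h2, ?_⟩
  rw [← hdelta, ← sign_eq_one_iff] at h3
  simp only [sign_mul, sign_pow, sign_prod_cross hc, Left.sign_neg, sign_one] at h3
  rw [pow_add _ m 3] at h3
  rcases neg_one_pow_eq_or SignType (sigNeg (affineForm fun i => q i - O)) with h4 | h4 <;>
  rcases neg_one_pow_eq_or SignType m with h5 | h5 <;>
  rcases neg_one_pow_eq_or SignType (q.numPositive O) with h6 | h6 <;>
  rw [h4, h5, h6] at h3 <;> rw [h4, h6] <;> revert h3 <;>
  generalize SignType.sign (q.delta O) = s <;> revert s <;> decide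

end PlanarPolygon

/-! ### Infinitesimal motions and the Lagrange function -/

lemma Fin.sum_add_one {N : ℕ} {M : Type*} [AddCommMonoid M] (f : Fin (N + 1) → M) :
    ∑ i, f (i + 1) = ∑ i, f i :=
  Equiv.sum_comp (Equiv.addRight 1) f

lemma rot_sub (u v : Plane) : rot (u - v) = rot u - rot v := by
  ext i
  fin_cases i
  · simp only [Fin.zero_eta, rot_apply_zero, PiLp.sub_apply]; ring
  · simp only [Fin.mk_one, rot_apply_one, PiLp.sub_apply]

lemma rot_smul (c : ℝ) (u : Plane) : rot (c • u) = c • rot u := by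
  ext i
  fin_cases i <;> simp

lemma rot_rot (u : Plane) : rot (rot u) = -u := by
  ext i
  fin_cases i <;> simp

lemma inner_rot_left (u v : Plane) : inner ℝ (rot u) v = cross u v := by
  simp only [inner_plane, cross, rot_apply_zero, rot_apply_one]
  ring

lemma norm_rot_sq (u : Plane) : ‖rot u‖ ^ 2 = ‖u‖ ^ 2 := by
  rw [← real_inner_self_eq_norm_sq, ← real_inner_self_eq_norm_sq]
  simp only [inner_plane, rot_apply_zero, rot_apply_one]
  ring

/-- A vector orthogonal to `v ≠ 0` is a multiple of `rot v`. -/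
lemma eq_smul_rot_of_inner_eq_zero {v w : Plane} (hv : v ≠ 0) (h : inner ℝ v w = 0) :
    w = (cross v w / ‖v‖ ^ 2) • rot v := by
  have hn : ‖v‖ ^ 2 ≠ 0 := pow_ne_zero 2 (norm_ne_zero_iff.mpr hv)
  have h1 : ‖v‖ ^ 2 = v 0 * v 0 + v 1 * v 1 := by
    rw [← real_inner_self_eq_norm_sq, inner_plane]
  rw [inner_plane] at h
  have key : ‖v‖ ^ 2 • w = cross v w • rot v := by
    ext i
    fin_cases i
    · simp only [Fin.zero_eta, PiLp.smul_apply, smul_eq_mul, rot_apply_zero, cross]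
      linear_combination w 0 * h1 + v 0 * h
    · simp only [Fin.mk_one, PiLp.smul_apply, smul_eq_mul, rot_apply_one, cross]
      linear_combination w 1 * h1 + v 1 * h
  rw [div_eq_inv_mul, mul_smul, ← key, smul_smul, inv_mul_cancel₀ hn, one_smul]

/-- A chord is orthogonal to the line from the centre to its midpoint; the ratio of lengths becomes
the Lagrange multiplier. -/
lemma two_mul_cross_smul_sub {u v : Plane} (h : ‖v‖ = ‖u‖) :
    (2 * cross u v) • (v - u) = ‖v - u‖ ^ 2 • rot (u + v) := by
  have h1 : ‖u‖ ^ 2 = u 0 * u 0 + u 1 * u 1 := by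
    rw [← real_inner_self_eq_norm_sq, inner_plane]
  have h2 : ‖u‖ ^ 2 = v 0 * v 0 + v 1 * v 1 := by
    rw [← h, ← real_inner_self_eq_norm_sq, inner_plane]
  rw [norm_sub_sq_real, h]
  ext i
  fin_cases i
  · simp only [cross, inner_plane, Fin.zero_eta, PiLp.smul_apply, PiLp.add_apply, PiLp.sub_apply,
      rot_apply_zero, smul_eq_mul]
    linear_combination 2 * (v 1) * h1 + 2 * (u 1) * h2
  · simp only [cross, inner_plane, Fin.mk_one, PiLp.smul_apply, PiLp.add_apply, PiLp.sub_apply,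
      rot_apply_one, smul_eq_mul]
    linear_combination -2 * (v 0) * h1 - 2 * (u 0) * h2

namespace PlanarPolygon

variable {m : ℕ}

/-- The infinitesimal motions of the polygon `q` which preserve its edge lengths and fix its first
two vertices. -/
def flexes (q : PlanarPolygon m) : Submodule ℝ (PlanarPolygon m) where
  carrier := {w | w 0 = 0 ∧ w 1 = 0 ∧ ∀ i, inner ℝ (q (i + 1) - q i) (w (i + 1) - w i) = 0}
  zero_mem' := by simp
  add_mem' := fun {a b} ha hb => by
    refine ⟨by simp [ha.1, hb.1], by simp [ha.2.1, hb.2.1], fun i => ?_⟩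
    have h1 := ha.2.2 i
    have h2 := hb.2.2 i
    rw [Pi.add_apply, Pi.add_apply, add_sub_add_comm, inner_add_right, h1, h2, add_zero]
  smul_mem' := fun c a ha => by
    refine ⟨by simp [ha.1], by simp [ha.2.1], fun i => ?_⟩
    rw [Pi.smul_apply, Pi.smul_apply, ← smul_sub, inner_smul_right, ha.2.2 i, mul_zero]

/-- The angular velocity of the `i`-th edge of `q` under the infinitesimal motion `w`. -/
noncomputable def angularVelocity (q w : PlanarPolygon m) (i : Fin (m + 3)) : ℝ :=
  cross (q (i + 1) - q i) (w (i + 1) - w i) / ‖q (i + 1) - q i‖ ^ 2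

lemma angularVelocity_add (q a b : PlanarPolygon m) (i : Fin (m + 3)) :
    q.angularVelocity (a + b) i = q.angularVelocity a i + q.angularVelocity b i := by
  rw [angularVelocity, Pi.add_apply, Pi.add_apply, add_sub_add_comm, cross_add_right, add_div]
  rfl

lemma angularVelocity_smul (q a : PlanarPolygon m) (c : ℝ) (i : Fin (m + 3)) :
    q.angularVelocity (c • a) i = c * q.angularVelocity a i := by
  rw [angularVelocity, Pi.smul_apply, Pi.smul_apply, ← smul_sub, cross_smul_right, mul_div_assoc]
  rfl

lemma sub_eq_angularVelocity_smul {q w : PlanarPolygon m} (he : ∀ i, q i ≠ q (i + 1))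
    (hw : w ∈ q.flexes) (i : Fin (m + 3)) :
    w (i + 1) - w i = q.angularVelocity w i • rot (q (i + 1) - q i) :=
  eq_smul_rot_of_inner_eq_zero (sub_ne_zero.mpr (he i).symm) (hw.2.2 i)

/-- The relative angular velocity, at the `i`-th vertex of `q`, of the two edges that meet there. -/
noncomputable def bending (q w : PlanarPolygon m) (i : Fin (m + 3)) : ℝ :=
  q.angularVelocity w (i - 1) - q.angularVelocity w i

/-- Both conditions say that an edge-preserving motion of a closed polygon keeps it closed: the sum
telescopes around the polygon. -/
lemma bending_mem {q w : PlanarPolygon m} (O : Plane) (he : ∀ i, q i ≠ q (i + 1))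
    (hw : w ∈ q.flexes) : q.bending w ∈ affineRelations fun i => q i - O := by
  constructor
  · rw [mem_linearRelations, ← Fin.sum_add_one]
    have h1 : ∀ i, q.bending w (i + 1) • (q (i + 1) - O) =
        (rot (w i) - q.angularVelocity w i • (O - q i)) -
          (rot (w (i + 1)) - q.angularVelocity w (i + 1) • (O - q (i + 1))) := by
      intro i
      have h := congrArg rot (sub_eq_angularVelocity_smul he hw i)
      rw [rot_sub, rot_smul, rot_rot] at h
      rw [bending, add_sub_cancel_right, sub_eq_iff_eq_add.mp h]
      module
    simp only [h1, Finset.sum_sub_distrib]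
    rw [Fin.sum_add_one (fun i => rot (w i)),
      Fin.sum_add_one (fun i => q.angularVelocity w i • (O - q i)), sub_self]
  · rw [← Fin.sum_add_one]
    simp only [bending, add_sub_cancel_right, Finset.sum_sub_distrib]
    rw [Fin.sum_add_one (q.angularVelocity w), sub_self]

/-- Infinitesimal motions of a polygon as affine relations between its vertices. -/
noncomputable def bendingMap (q : PlanarPolygon m) (O : Plane) (he : ∀ i, q i ≠ q (i + 1)) :
    q.flexes →ₗ[ℝ] affineRelations fun i => q i - O where
  toFun w := ⟨q.bending w, bending_mem O he w.2⟩
  map_add' a b := by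
    ext i
    simp only [bending, Submodule.coe_add, angularVelocity_add, Pi.add_apply]
    ring
  map_smul' c a := by
    ext i
    simp only [bending, Submodule.coe_smul, angularVelocity_smul, Pi.smul_apply, RingHom.id_apply,
      smul_eq_mul]
    ring

lemma bendingMap_injective (q : PlanarPolygon m) (O : Plane) (he : ∀ i, q i ≠ q (i + 1)) :
    Function.Injective (q.bendingMap O he) := by
  rw [← LinearMap.ker_eq_bot, LinearMap.ker_eq_bot']
  rintro ⟨w, hw⟩ h
  have h1 : ∀ i, q.bending w i = 0 := fun i => congrFun (congrArg Subtype.val h) i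
  -- the edge between the two fixed vertices does not rotate, hence no edge does
  have h2 : ∀ i, q.angularVelocity w i = 0 := by
    intro i
    induction i using Fin.induction with
    | zero =>
      rw [angularVelocity, zero_add, hw.1, hw.2.1, sub_self, cross_zero_right, zero_div]
    | succ i ih =>
      have := h1 i.succ
      rw [bending, ← Fin.coeSucc_eq_succ, add_sub_cancel_right, ih, zero_sub, neg_eq_zero] at this
      rwa [← Fin.coeSucc_eq_succ]
  ext1
  funext i
  change w i = 0
  induction i using Fin.induction with
  | zero => exact hw.1
  | succ i ih =>
    have := sub_eq_angularVelocity_smul he hw i.castSucc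
    rwa [h2, zero_smul, sub_eq_zero, ih, Fin.coeSucc_eq_succ] at this

/-- The Lagrange multiplier of the length of the `i`-th edge of a polygon with vertices `x i`
on a circle centred at the origin. -/
noncomputable def multiplier (x : PlanarPolygon m) (i : Fin (m + 3)) : ℝ :=
  cross (x i) (x (i + 1)) / (2 * ‖x (i + 1) - x i‖ ^ 2)

/-- The symmetric bilinear form of the quadratic Lagrange function: the signed area minus the sum
of the squared edge lengths with weights `multiplier x i`. -/
noncomputable def lagrangian (x : PlanarPolygon m) : LinearMap.BilinForm ℝ (PlanarPolygon m) :=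
  LinearMap.mk₂ ℝ (fun a b => ∑ i, ((cross (a i) (b (i + 1)) + cross (b i) (a (i + 1))) / 4 -
      x.multiplier i * inner ℝ (a (i + 1) - a i) (b (i + 1) - b i)))
    (fun a b c => by
      rw [← Finset.sum_add_distrib]
      refine Finset.sum_congr rfl fun i _ => ?_
      simp only [inner_plane, cross, Pi.add_apply, PiLp.add_apply, PiLp.sub_apply]
      ring)
    (fun c a b => by
      rw [smul_eq_mul, Finset.mul_sum]
      refine Finset.sum_congr rfl fun i _ => ?_
      simp only [inner_plane, cross, Pi.smul_apply, PiLp.smul_apply, PiLp.sub_apply, smul_eq_mul]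
      ring)
    (fun a b c => by
      rw [← Finset.sum_add_distrib]
      refine Finset.sum_congr rfl fun i _ => ?_
      simp only [inner_plane, cross, Pi.add_apply, PiLp.add_apply, PiLp.sub_apply]
      ring)
    (fun c a b => by
      rw [smul_eq_mul, Finset.mul_sum]
      refine Finset.sum_congr rfl fun i _ => ?_
      simp only [inner_plane, cross, Pi.smul_apply, PiLp.smul_apply, PiLp.sub_apply, smul_eq_mul]
      ring)

lemma lagrangian_apply (x a b : PlanarPolygon m) : x.lagrangian a b =
    ∑ i, ((cross (a i) (b (i + 1)) + cross (b i) (a (i + 1))) / 4 -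
      x.multiplier i * inner ℝ (a (i + 1) - a i) (b (i + 1) - b i)) := rfl

lemma lagrangian_comm (x a b : PlanarPolygon m) : x.lagrangian a b = x.lagrangian b a := by
  rw [lagrangian_apply, lagrangian_apply]
  refine Finset.sum_congr rfl fun i _ => ?_
  rw [real_inner_comm, add_comm (cross (a i) _)]

/-- On a moduli space the correction term is constant. -/
lemma signedArea_eq_lagrangian (x y : PlanarPolygon m) :
    y.signedArea = x.lagrangian y y + ∑ i, x.multiplier i * y.sideLengths i ^ 2 := by
  rw [lagrangian_apply, signedArea, ← Finset.sum_add_distrib, Finset.mul_sum]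
  refine Finset.sum_congr rfl fun i _ => ?_
  rw [sideLengths, dist_comm, dist_eq_norm, real_inner_self_eq_norm_sq]
  ring

variable {q : PlanarPolygon m} {O : Plane} {r : ℝ}

/-- A cyclic polygon is a critical point of the Lagrange function. -/
lemma lagrangian_self_eq_zero (h : q.InscribedIn O r) (he : ∀ i, q i ≠ q (i + 1))
    (w : PlanarPolygon m) : lagrangian (fun i => q i - O) q w = 0 := by
  have hterm : ∀ i, (cross (q i) (w (i + 1)) + cross (w i) (q (i + 1))) / 4 -
      multiplier (fun i => q i - O) i * inner ℝ (q (i + 1) - q i) (w (i + 1) - w i) =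
      (cross O (w (i + 1)) - cross (q (i + 1) - O) (w (i + 1))) / 4 -
        (cross O (w i) - cross (q i - O) (w i)) / 4 := by
    intro i
    have hsm := two_mul_cross_smul_sub (u := q i - O) (v := q (i + 1) - O)
      (by rw [norm_vertex_sub h, norm_vertex_sub h])
    rw [sub_sub_sub_cancel_right] at hsm
    have hn : ‖q (i + 1) - q i‖ ^ 2 ≠ 0 :=
      pow_ne_zero 2 (norm_ne_zero_iff.mpr (sub_ne_zero.mpr (he i).symm))
    have hin := congrArg (fun u => inner ℝ u (w (i + 1) - w i)) hsm
    simp only [real_inner_smul_left, inner_rot_left] at hin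
    have hmul : multiplier (fun i => q i - O) i * inner ℝ (q (i + 1) - q i) (w (i + 1) - w i) =
        cross (q i - O + (q (i + 1) - O)) (w (i + 1) - w i) / 4 := by
      rw [multiplier, sub_sub_sub_cancel_right, div_mul_eq_mul_div,
        div_eq_div_iff (mul_ne_zero two_ne_zero hn) four_ne_zero]
      linarith
    rw [hmul]
    simp only [cross, PiLp.add_apply, PiLp.sub_apply]
    ring
  rw [lagrangian_apply]
  simp only [hterm, Finset.sum_sub_distrib]
  rw [Fin.sum_add_one (fun i => (cross O (w i) - cross (q i - O) (w i)) / 4), sub_self]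

/-- On infinitesimal motions, the second variation of the area is the area of the closed chain with
edges `bending i • (q i - O)`. -/
lemma two_mul_lagrangian_eq_chainForm (he : ∀ i, q i ≠ q (i + 1)) {w : PlanarPolygon m}
    (hw : w ∈ q.flexes) :
    2 * lagrangian (fun i => q i - O) w w = chainForm (fun i => q i - O) (q.bending w) := by
  have hmem := (bending_mem O he hw).1
  set θ := q.angularVelocity w with hθ
  have hstep : ∀ i, w (i + 1) - w i = θ i • rot (q (i + 1) - q i) :=
    sub_eq_angularVelocity_smul he hw
  -- the vertices of the chain with edges `bending i • (q i - O)`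
  have hz : ∀ i, -rot (w (i + 1)) - θ (i + 1) • (q (i + 1) - O) =
      (-rot (w i) - θ i • (q i - O)) + q.bending w (i + 1) • (q (i + 1) - O) := by
    intro i
    have h := congrArg rot (hstep i)
    rw [rot_sub, rot_smul, rot_rot] at h
    rw [bending, add_sub_cancel_right, ← hθ, sub_eq_iff_eq_add.mp h]
    module
  rw [chainForm_apply, ← sum_cross_eq_chainBilin (z := fun i => -rot (w i) - θ i • (q i - O)) hz
    hmem]
  have hterm : ∀ i, cross (-rot (w i) - θ i • (q i - O)) (q i - O) = inner ℝ (w i) (q i - O) := by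
    intro i
    simp only [inner_plane, cross, PiLp.sub_apply, PiLp.neg_apply, PiLp.smul_apply, smul_eq_mul,
      rot_apply_zero, rot_apply_one]
    ring
  simp only [hterm]
  have hparts : ∑ i, q.bending w i * inner ℝ (w i) (q i - O) =
      ∑ i, θ i * (inner ℝ (w (i + 1)) (q (i + 1) - O) - inner ℝ (w i) (q i - O)) := by
    simp only [mul_sub, Finset.sum_sub_distrib, bending, sub_mul, ← hθ]
    congr 1
    rw [← Fin.sum_add_one]
    simp only [add_sub_cancel_right]
  rw [hparts, lagrangian_apply, Finset.mul_sum]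
  refine Finset.sum_congr rfl fun i _ => ?_
  have hn : ‖q (i + 1) - q i‖ ^ 2 ≠ 0 :=
    pow_ne_zero 2 (norm_ne_zero_iff.mpr (sub_ne_zero.mpr (he i).symm))
  have hmul : multiplier (fun i => q i - O) i * inner ℝ (w (i + 1) - w i) (w (i + 1) - w i) =
      θ i ^ 2 * cross (q i - O) (q (i + 1) - O) / 2 := by
    rw [hstep, real_inner_smul_left, real_inner_smul_right, real_inner_self_eq_norm_sq,
      norm_rot_sq, multiplier, sub_sub_sub_cancel_right, div_mul_eq_mul_div,
      div_eq_div_iff (mul_ne_zero two_ne_zero hn) two_ne_zero]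
    ring
  have h0 := congrArg (fun u : Plane => u 0) (hstep i)
  have h1 := congrArg (fun u : Plane => u 1) (hstep i)
  simp only [PiLp.sub_apply, PiLp.smul_apply, smul_eq_mul, rot_apply_zero, rot_apply_one] at h0 h1
  rw [hmul]
  have e0 : w (i + 1) 0 = w i 0 - θ i * (q (i + 1) 1 - q i 1) := by linarith
  have e1 : w (i + 1) 1 = w i 1 + θ i * (q (i + 1) 0 - q i 0) := by linarith
  simp only [inner_plane, cross, PiLp.sub_apply, e0, e1]
  ring

end PlanarPolygon

/-! ### The Hessian in local coordinates -/

namespace LocalParam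

open PlanarPolygon Filter Topology

variable {m : ℕ} {L : Fin (m + 3) → ℝ} {q : PlanarPolygon m}

/-- The polygon with local coordinates `x`. -/
def toPolygon (φ : LocalParam L q) (x : EuclideanSpace ℝ (Fin m)) : PlanarPolygon m :=
  φ.chart x

lemma toPolygon_zero (φ : LocalParam L q) : φ.toPolygon 0 = q := φ.map_zero

lemma source_mem_nhds (φ : LocalParam L q) {x : EuclideanSpace ℝ (Fin m)}
    (hx : x ∈ φ.chart.source) : φ.chart.source ∈ 𝓝 x :=
  φ.chart.open_source.mem_nhds hx

lemma contDiffAt_toPolygon (φ : LocalParam L q) {x : EuclideanSpace ℝ (Fin m)}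
    (hx : x ∈ φ.chart.source) : ContDiffAt ℝ ∞ φ.toPolygon x :=
  φ.contDiffOn.contDiffAt (φ.source_mem_nhds hx)

lemma hasFDerivAt_toPolygon (φ : LocalParam L q) {x : EuclideanSpace ℝ (Fin m)}
    (hx : x ∈ φ.chart.source) : HasFDerivAt φ.toPolygon (fderiv ℝ φ.toPolygon x) x :=
  ((φ.contDiffAt_toPolygon hx).differentiableAt (by simp)).hasFDerivAt

lemma fderiv_toPolygon_mem_flexes (φ : LocalParam L q) (u : EuclideanSpace ℝ (Fin m)) :
    fderiv ℝ φ.toPolygon 0 u ∈ q.flexes := by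
  have hD := φ.hasFDerivAt_toPolygon φ.zero_mem
  set D := fderiv ℝ φ.toPolygon 0
  have hcomp : ∀ i, HasFDerivAt (fun x => φ.toPolygon x i)
      ((ContinuousLinearMap.proj i).comp D) 0 := fun i => hasFDerivAt_pi'.mp hD i
  have hmem : ∀ x, φ.toPolygon x ∈ moduliSpace L := fun x => (φ.chart x).2
  refine ⟨?_, ?_, fun i => ?_⟩
  · have h0 : (fun x => φ.toPolygon x 0) = fun _ => 0 := funext fun x => (hmem x).2.1
    have h1 := hcomp 0
    rw [h0] at h1
    exact DFunLike.congr_fun (h1.unique (hasFDerivAt_const _ _)) u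
  · have h0 : (fun x => φ.toPolygon x 1) = fun _ => !₂[0, L 0] := funext fun x => (hmem x).2.2
    have h1 := hcomp 1
    rw [h0] at h1
    exact DFunLike.congr_fun (h1.unique (hasFDerivAt_const _ _)) u
  · have h0 : (fun x => ‖φ.toPolygon x (i + 1) - φ.toPolygon x i‖ ^ 2) = fun _ => L i ^ 2 := by
      funext x
      have h1 := congrFun (hmem x).1 i
      rw [sideLengths, dist_comm, dist_eq_norm] at h1
      rw [h1]
    have h1 := ((hcomp (i + 1)).sub (hcomp i)).norm_sq
    simp only [Pi.sub_apply] at h1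
    rw [h0] at h1
    have h2 := DFunLike.congr_fun (h1.unique (hasFDerivAt_const _ _)) u
    rw [toPolygon_zero] at h2
    simpa [inner_sub_left, inner_sub_right] using h2

variable {O : Plane} {r : ℝ}

/-- On the moduli space, the area is a quadratic function of the displacement from `q`. -/
lemma area_eq (h : q.InscribedIn O r) (he : ∀ i, q i ≠ q (i + 1)) (φ : LocalParam L q)
    (x : EuclideanSpace ℝ (Fin m)) :
    φ.area x = lagrangian (fun i => q i - O) (φ.toPolygon x - q) (φ.toPolygon x - q) +
      ∑ i, multiplier (fun i => q i - O) i * L i ^ 2 := by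
  have hq := lagrangian_self_eq_zero h he
  rw [area, signedArea_eq_lagrangian fun i => q i - O, (φ.chart x).2.1]
  change lagrangian _ (φ.toPolygon x) (φ.toPolygon x) + _ = _
  simp only [map_sub, LinearMap.sub_apply, hq, lagrangian_comm _ _ q, sub_zero]

lemma hasFDerivAt_area (h : q.InscribedIn O r) (he : ∀ i, q i ≠ q (i + 1)) (φ : LocalParam L q)
    {x : EuclideanSpace ℝ (Fin m)} (hx : x ∈ φ.chart.source) :
    HasFDerivAt φ.area (((2 : ℝ) • (lagrangian fun i => q i - O).toContinuousBilinearMap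
      (φ.toPolygon x - q)).comp (fderiv ℝ φ.toPolygon x)) x := by
  set G := (lagrangian fun i => q i - O).toContinuousBilinearMap
  have hD := (φ.hasFDerivAt_toPolygon hx).sub_const q
  have h1 := ((G.hasFDerivAt.comp x hD).clm_apply hD).add_const
    (∑ i, multiplier (fun i => q i - O) i * L i ^ 2)
  have h2 : φ.area = fun x => G (φ.toPolygon x - q) (φ.toPolygon x - q) +
      ∑ i, multiplier (fun i => q i - O) i * L i ^ 2 := funext (area_eq h he φ)
  rw [h2]
  refine h1.congr_fderiv ?_
  ext u
  have hcomm : ∀ a b, G a b = G b a := lagrangian_comm _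
  simp only [add_apply, ContinuousLinearMap.comp_apply,
    ContinuousLinearMap.flip_apply, smul_apply, smul_eq_mul,
    Function.comp_apply, hcomm (fderiv ℝ φ.toPolygon x u)]
  ring

lemma isCritical (h : q.InscribedIn O r) (he : ∀ i, q i ≠ q (i + 1)) (φ : LocalParam L q) :
    φ.IsCritical := by
  rw [IsCritical, (hasFDerivAt_area h he φ φ.zero_mem).fderiv, toPolygon_zero, sub_self]
  simp

/-- The second derivative of the area only involves the first derivative of the parametrization,
since the Lagrange function is quadratic in the displacement, which vanishes at `0`. -/
lemma fderiv_fderiv_area (h : q.InscribedIn O r) (he : ∀ i, q i ≠ q (i + 1))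
    (φ : LocalParam L q) (u v : EuclideanSpace ℝ (Fin m)) :
    fderiv ℝ (fderiv ℝ φ.area) 0 u v = 2 * lagrangian (fun i => q i - O)
      (fderiv ℝ φ.toPolygon 0 u) (fderiv ℝ φ.toPolygon 0 v) := by
  set G := (lagrangian fun i => q i - O).toContinuousBilinearMap with hG
  have heq : fderiv ℝ φ.area =ᶠ[𝓝 0] fun x =>
      ((2 : ℝ) • G (φ.toPolygon x - q)).comp (fderiv ℝ φ.toPolygon x) := by
    filter_upwards [φ.source_mem_nhds φ.zero_mem] with x hx
    exact (hasFDerivAt_area h he φ hx).fderiv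
  have hD := (φ.hasFDerivAt_toPolygon φ.zero_mem).sub_const q
  have hc := (G.hasFDerivAt.comp 0 hD).const_smul (2 : ℝ)
  have hd : DifferentiableAt ℝ (fderiv ℝ φ.toPolygon) 0 :=
    ((φ.contDiffAt_toPolygon φ.zero_mem).fderiv_right (m := 1) (by norm_cast)).differentiableAt
      (by simp)
  have h1 := hc.clm_comp hd.hasFDerivAt
  rw [heq.fderiv_eq]
  erw [h1.fderiv]
  simp [toPolygon_zero]
  rfl

/-- The differential at `0` of the parametrization, as a linear map to the infinitesimal motions. -/
noncomputable def differential (φ : LocalParam L q) : (Fin m → ℝ) →ₗ[ℝ] q.flexes :=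
  ((fderiv ℝ φ.toPolygon 0).toLinearMap.codRestrict q.flexes φ.fderiv_toPolygon_mem_flexes).comp
    (WithLp.linearEquiv 2 ℝ (Fin m → ℝ)).symm.toLinearMap

lemma differential_injective (φ : LocalParam L q) : Function.Injective φ.differential := by
  intro u v huv
  exact (WithLp.linearEquiv 2 ℝ (Fin m → ℝ)).symm.injective
    (φ.injective_fderiv 0 φ.zero_mem (congrArg Subtype.val huv))

lemma hess_eq (h : q.InscribedIn O r) (he : ∀ i, q i ≠ q (i + 1)) (φ : LocalParam L q) :
    φ.hess = LinearMap.toMatrix₂' ℝ (((2 : ℝ) • lagrangian fun i => q i - O).compl₁₂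
      (q.flexes.subtype ∘ₗ φ.differential) (q.flexes.subtype ∘ₗ φ.differential)) := by
  ext i j
  rw [LinearMap.toMatrix₂'_apply, hess, Matrix.of_apply, fderiv_fderiv_area h he]
  rfl

lemma hess_isSymm (h : q.InscribedIn O r) (he : ∀ i, q i ≠ q (i + 1)) (φ : LocalParam L q) :
    φ.hess.IsSymm := by
  refine Matrix.IsSymm.ext fun i j => ?_
  rw [hess, Matrix.of_apply, Matrix.of_apply, fderiv_fderiv_area h he, fderiv_fderiv_area h he,
    lagrangian_comm]

lemma toQuadraticForm'_hess (h : q.InscribedIn O r) (he : ∀ i, q i ≠ q (i + 1))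
    (φ : LocalParam L q) (u : Fin m → ℝ) :
    φ.hess.toQuadraticForm' u =
      affineForm (fun i => q i - O) (q.bendingMap O he (φ.differential u)) := by
  rw [Matrix.toQuadraticForm', hess_eq h he, Matrix.toLinearMap₂'_toMatrix',
    LinearMap.BilinMap.toQuadraticMap_apply, affineForm_apply]
  exact two_mul_lagrangian_eq_chainForm he (φ.differential u).2

/-- In every smooth local parametrization, the Hessian of the area is equivalent to the area form on
the affine relations between the vertices. -/
lemma hess_equivalent (h : q.InscribedIn O r) (he : ∀ i, q i ≠ q (i + 1))
    (hdim : Module.finrank ℝ (affineRelations fun i => q i - O) = m) (φ : LocalParam L q) :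
    QuadraticMap.Equivalent φ.hess.toQuadraticForm' (affineForm fun i => q i - O) := by
  have hinj : Function.Injective (q.bendingMap O he ∘ₗ φ.differential) :=
    (q.bendingMap_injective O he).comp φ.differential_injective
  exact ⟨⟨LinearMap.linearEquivOfInjective _ hinj (by rw [hdim, Module.finrank_fin_fun]),
    fun u => (toQuadraticForm'_hess h he φ u).symm⟩⟩

lemma morseIndex_eq (h : q.InscribedIn O r) (he : ∀ i, q i ≠ q (i + 1))
    (hdim : Module.finrank ℝ (affineRelations fun i => q i - O) = m) (φ : LocalParam L q) :
    φ.morseIndex = sigNeg (affineForm fun i => q i - O) :=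
  (hess_equivalent h he hdim φ).sigNeg_eq

lemma hessSign_eq (h : q.InscribedIn O r) (he : ∀ i, q i ≠ q (i + 1))
    (hdim : Module.finrank ℝ (affineRelations fun i => q i - O) = m)
    (hfull : FullRank (affineForm fun i => q i - O)) (φ : LocalParam L q) :
    φ.hessSign = (-1) ^ sigNeg (affineForm fun i => q i - O) := by
  have he' := hess_equivalent h he hdim φ
  rw [FullRank, hdim] at hfull
  rw [hessSign, ← he'.sigNeg_eq]
  refine sign_det_eq_neg_one_pow_sigNeg (hess_isSymm h he φ) ?_
  rw [FullRank, he'.sigPos_eq, he'.sigNeg_eq, hfull, Module.finrank_fin_fun]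

end LocalParam

/-! ### Existence of local coordinates -/

open Topology Filter in
/-- A level set of a smooth map with surjective differential is locally parametrized by `m`
parameters. Surjectivity is expressed by a bound on the kernel of the differential and a count of
dimensions. -/
lemma exists_chart_levelSet {E F : Type*} [NormedAddCommGroup E] [NormedSpace ℝ E]
    [FiniteDimensional ℝ E] [NormedAddCommGroup F] [NormedSpace ℝ F] [FiniteDimensional ℝ F]
    {m : ℕ} {C : E → F} (hC : ContDiff ℝ ∞ C) {q : E} {M : Set E} (hM : ∀ y, y ∈ M ↔ C y = C q)
    (hdim : Module.finrank ℝ E = Module.finrank ℝ F + m)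
    (f : LinearMap.ker (fderiv ℝ C q).toLinearMap →ₗ[ℝ] EuclideanSpace ℝ (Fin m))
    (hf : Function.Injective f) :
    ∃ chart : OpenPartialHomeomorph (EuclideanSpace ℝ (Fin m)) M,
      0 ∈ chart.source ∧ (chart 0 : E) = q ∧
      ContDiffOn ℝ ∞ (fun x => (chart x : E)) chart.source ∧
      ∀ x ∈ chart.source, Function.Injective (fderiv ℝ (fun x => (chart x : E)) x) := by
  have hqM : q ∈ M := (hM q).mpr rfl
  have : CompleteSpace E := FiniteDimensional.complete ℝ E
  obtain ⟨π₀, hπ₀⟩ := LinearMap.exists_extend f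
  set π : E →L[ℝ] EuclideanSpace ℝ (Fin m) := LinearMap.toContinuousLinearMap π₀ with hπ
  set H : E → F × EuclideanSpace ℝ (Fin m) := fun y => (C y, π (y - q)) with hH
  have hHsm : ContDiff ℝ ∞ H :=
    hC.prodMk (π.contDiff.comp (contDiff_id.sub contDiff_const))
  have hH' : HasFDerivAt H ((fderiv ℝ C q).prod π) q :=
    ((hC.differentiable (by simp)).differentiableAt.hasFDerivAt).prodMk
      (π.hasFDerivAt.comp q ((hasFDerivAt_id q).sub_const q))
  have hinj : Function.Injective ((fderiv ℝ C q).prod π).toLinearMap := by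
    rw [← LinearMap.ker_eq_bot, LinearMap.ker_eq_bot']
    intro y hy
    obtain ⟨h1, h2⟩ := Prod.mk.inj hy
    have h3 : f ⟨y, h1⟩ = 0 := by
      rw [← hπ₀]
      exact h2
    exact congrArg Subtype.val (hf (h3.trans (map_zero f).symm))
  let A : E ≃L[ℝ] F × EuclideanSpace ℝ (Fin m) :=
    (LinearMap.linearEquivOfInjective _ hinj (by
      rw [Module.finrank_prod, finrank_euclideanSpace_fin, hdim])).toContinuousLinearEquiv
  have hA : HasFDerivAt H (A : E →L[ℝ] F × EuclideanSpace ℝ (Fin m)) q := by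
    convert hH'
    ext y <;> rfl
  set e₀ := hHsm.contDiffAt.toOpenPartialHomeomorph H hA (by simp) with he₀
  -- the open set where the differential of `H` is invertible
  set U : Set E := fderiv ℝ H ⁻¹' Set.range ((↑) : (E ≃L[ℝ] F × EuclideanSpace ℝ (Fin m)) →
    E →L[ℝ] F × EuclideanSpace ℝ (Fin m)) with hU
  have hUo : IsOpen U := (ContinuousLinearEquiv.isOpen).preimage
    (hHsm.continuous_fderiv (by simp))
  set e := e₀.restrOpen U hUo with he
  have heH : ∀ y, e y = H y := fun y => rfl
  have hqe : q ∈ e.source :=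
    ⟨hHsm.contDiffAt.mem_toOpenPartialHomeomorph_source hA (by simp), A, hA.fderiv.symm⟩
  have hsymm : ∀ p ∈ e.target, ContDiffAt ℝ ∞ e.symm p := by
    intro p hp
    have hmem := e.map_target hp
    obtain ⟨B, hB⟩ := hmem.2
    refine e.contDiffAt_symm hp (f₀' := B) ?_ hHsm.contDiffAt
    rw [hB]
    exact (hHsm.differentiable (by simp)).differentiableAt.hasFDerivAt
  have hright : ∀ p ∈ e.target, H (e.symm p) = p := fun p hp => e.right_inv hp
  set j : EuclideanSpace ℝ (Fin m) → F × EuclideanSpace ℝ (Fin m) := fun z => (C q, z) with hj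
  have hjsm : ContDiff ℝ ∞ j := contDiff_const.prodMk contDiff_id
  have hMH : ∀ p ∈ M, H p = j (π (p - q)) := fun p hp => by simp only [hH, hj, (hM p).mp hp]
  have hjM : ∀ z, j z ∈ e.target → e.symm (j z) ∈ M := fun z hz =>
    (hM _).mpr (congrArg Prod.fst (hright _ hz))
  classical
  let g : EuclideanSpace ℝ (Fin m) → M := fun z =>
    if h : j z ∈ e.target then ⟨e.symm (j z), hjM z h⟩ else ⟨q, hqM⟩
  have hg : ∀ z, j z ∈ e.target → (g z : E) = e.symm (j z) := fun z hz => by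
    simp only [g, dif_pos hz]
  have hsrc : IsOpen (j ⁻¹' e.target) := e.open_target.preimage hjsm.continuous
  have hmaps : ∀ p : M, (p : E) ∈ e.source → j (π (p - q)) ∈ e.target := fun p hp => by
    rw [← hMH p p.2, ← heH]
    exact e.map_source hp
  let chart : OpenPartialHomeomorph (EuclideanSpace ℝ (Fin m)) M :=
    { toFun := g
      invFun := fun p => π (p - q)
      source := j ⁻¹' e.target
      target := {p | (p : E) ∈ e.source}
      map_source' := fun z hz => by
        change (g z : E) ∈ e.source
        rw [hg z hz]
        exact e.map_target hz
      map_target' := fun p hp => hmaps p hp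
      left_inv' := fun z hz => by
        rw [hg z hz]
        exact congrArg Prod.snd (hright _ hz)
      right_inv' := fun p hp => by
        ext1
        rw [hg _ (hmaps p hp), ← hMH p p.2, ← heH]
        exact e.left_inv hp
      open_source := hsrc
      open_target := e.open_source.preimage continuous_subtype_val
      continuousOn_toFun := by
        rw [Topology.IsInducing.subtypeVal.continuousOn_iff]
        refine ContinuousOn.congr (f := e.symm ∘ j) ?_ hg
        exact e.symm.continuousOn.comp hjsm.continuous.continuousOn (fun z hz => hz)
      continuousOn_invFun := by fun_prop }
  have hsm : ∀ z ∈ chart.source, ContDiffAt ℝ ∞ (fun x => (chart x : E)) z := by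
    intro z hz
    refine ContDiffAt.congr_of_eventuallyEq (f := e.symm ∘ j)
      ((hsymm _ hz).comp z hjsm.contDiffAt) ?_
    filter_upwards [hsrc.mem_nhds hz] with y hy using hg y hy
  have hjq : j 0 = e q := by rw [heH, hMH q hqM, sub_self, map_zero]
  have h0 : j 0 ∈ e.target := by
    rw [hjq]
    exact e.map_source hqe
  refine ⟨chart, h0, ?_, fun z hz => (hsm z hz).contDiffWithinAt, fun z hz => ?_⟩
  · change (g 0 : E) = q
    rw [hg 0 h0, hjq]
    exact e.left_inv hqe
  · have hd := ((hsm z hz).differentiableAt (by simp)).hasFDerivAt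
    have h1 := π.hasFDerivAt.comp z (hd.sub_const q)
    have h2 : (fun x => π ((chart x : E) - q)) =ᶠ[𝓝 z] id := by
      filter_upwards [hsrc.mem_nhds hz] with y hy using chart.left_inv hy
    have h3 := (h1.congr_of_eventuallyEq h2.symm).unique (hasFDerivAt_id z)
    exact Function.LeftInverse.injective (g := π) fun u => DFunLike.congr_fun h3 u

namespace PlanarPolygon

variable {m : ℕ} {L : Fin (m + 3) → ℝ} {q : PlanarPolygon m} {O : Plane} {r : ℝ}

/-- The positions of the first two vertices and the squared lengths of all edges but the one between
them. -/
noncomputable def constraints (y : PlanarPolygon m) : Plane × Plane × (Fin (m + 2) → ℝ) :=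
  (y 0, y 1, fun i => ‖y (i.succ + 1) - y i.succ‖ ^ 2)

lemma contDiff_constraints : ContDiff ℝ ∞ (constraints (m := m)) := by
  refine ContDiff.prodMk (by fun_prop) (ContDiff.prodMk (by fun_prop) ?_)
  rw [contDiff_pi]
  intro i
  exact ContDiff.norm_sq ℝ (by fun_prop)

lemma mem_moduliSpace_iff_constraints (hq : q ∈ moduliSpace L) (y : PlanarPolygon m) :
    y ∈ moduliSpace L ↔ constraints y = constraints q := by
  have hn : ∀ (z : PlanarPolygon m) i, ‖z (i + 1) - z i‖ = z.sideLengths i := fun z i => by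
    rw [sideLengths, dist_comm, dist_eq_norm]
  constructor
  · intro hy
    simp only [constraints, hn, hy.1, hq.1, hy.2.1, hq.2.1, hy.2.2, hq.2.2]
  · intro h
    simp only [constraints, hn, Prod.mk.injEq] at h
    obtain ⟨h0, h1, h2⟩ := h
    refine ⟨?_, h0.trans hq.2.1, h1.trans hq.2.2⟩
    rw [← hq.1]
    funext i
    refine Fin.cases ?_ (fun i => ?_) i
    · simp only [sideLengths, zero_add, h0, h1]
    · exact (pow_left_inj₀ dist_nonneg dist_nonneg two_ne_zero).mp (congrFun h2 i)

lemma ker_fderiv_constraints_le :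
    LinearMap.ker (fderiv ℝ constraints q).toLinearMap ≤ q.flexes := by
  intro w hw
  have hd : ∀ i, HasFDerivAt (𝕜 := ℝ) (fun y : PlanarPolygon m => y i)
      (ContinuousLinearMap.proj (R := ℝ) i) q :=
    fun i => hasFDerivAt_apply (𝕜 := ℝ) i q
  have hC := (hd 0).prodMk ((hd 1).prodMk (hasFDerivAt_pi.mpr fun i : Fin (m + 2) =>
    ((hd (i.succ + 1)).sub (hd i.succ)).norm_sq))
  have hw' : fderiv ℝ constraints q w = 0 := hw
  rw [show fderiv ℝ constraints q = _ from hC.fderiv] at hw'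
  obtain ⟨h0, h12⟩ := Prod.mk.inj hw'
  obtain ⟨h1, h2⟩ := Prod.mk.inj h12
  have h0' : w 0 = 0 := h0
  have h1' : w 1 = 0 := h1
  refine ⟨h0', h1', fun i => ?_⟩
  refine Fin.cases ?_ (fun i => ?_) i
  · rw [zero_add, h0', h1', sub_self, inner_zero_right]
  · have := congrFun h2 i
    simpa [inner_sub_left, inner_sub_right] using this

/-- The moduli space is a manifold around a polygon with an `m`-dimensional space of affine relations
between its vertices. -/
lemma nonempty_localParam (hq : q ∈ moduliSpace L) (O : Plane) (he : ∀ i, q i ≠ q (i + 1))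
    (hdim : Module.finrank ℝ (affineRelations fun i => q i - O) = m) :
    Nonempty (LocalParam L q) := by
  have hfin : Module.finrank ℝ (affineRelations fun i => q i - O) =
      Module.finrank ℝ (EuclideanSpace ℝ (Fin m)) := by rw [hdim, finrank_euclideanSpace_fin]
  obtain ⟨chart, h1, h2, h3, h4⟩ := exists_chart_levelSet contDiff_constraints
    (mem_moduliSpace_iff_constraints hq) (m := m) (by
      simp only [Module.finrank_prod, Module.finrank_pi_fintype, finrank_euclideanSpace_fin,
        Module.finrank_self, Finset.sum_const, Finset.card_univ, Fintype.card_fin, smul_eq_mul]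
      ring)
    ((LinearEquiv.ofFinrankEq _ _ hfin).toLinearMap ∘ₗ q.bendingMap O he ∘ₗ
      Submodule.inclusion ker_fderiv_constraints_le)
    ((LinearEquiv.injective _).comp ((q.bendingMap_injective O he).comp
      (Submodule.inclusion_injective _)))
  exact ⟨⟨chart, h1, h2, h3, h4⟩⟩

end PlanarPolygon

/-! ### Counting sign changes -/

/-- Adding a point on the circle raises the negative index of a nondegenerate area form by at most
one. -/
lemma sigNeg_affineForm_snoc {n : ℕ} (x : Fin (n + 1) → Plane)
    (hdim : Module.finrank ℝ (affineRelations x) =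
      Module.finrank ℝ (affineRelations fun i => x i.castSucc) + 1)
    (hfull : FullRank (affineForm x)) (hfull' : FullRank (affineForm fun i => x i.castSucc)) :
    sigNeg (affineForm x) = sigNeg (affineForm fun i => x i.castSucc) ∨
      sigNeg (affineForm x) = sigNeg (affineForm fun i => x i.castSucc) + 1 := by
  have h1 := sigNeg_le_of_injective _ (affineRelationsSnoc_injective x) (affineForm_snoc x)
  have h2 := sigPos_le_of_injective _ (affineRelationsSnoc_injective x) (affineForm_snoc x)
  unfold FullRank at hfull hfull'
  omega

lemma Fin.eq_add_sum_of_succ {m : ℕ} (f : Fin (m + 1) → ℕ) (d : Fin m → ℕ)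
    (h : ∀ k, f k.succ = f k.castSucc + d k) : f (Fin.last m) = f 0 + ∑ k, d k := by
  induction m with
  | zero => simp
  | succ m ih =>
    rw [Fin.sum_univ_castSucc, ← Fin.succ_last, h, ← add_assoc]
    congr 1
    exact ih (fun k => f k.castSucc) (fun k => d k.castSucc) (fun k => h k.castSucc)

/-- If the exponents start at zero and grow by at most one at each step, the last of them is the
number of sign changes. -/
lemma signChanges_neg_one_pow {m : ℕ} (f : Fin (m + 1) → ℕ) (h0 : f 0 = 0)
    (h : ∀ k : Fin m, f k.succ = f k.castSucc ∨ f k.succ = f k.castSucc + 1) :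
    signChanges (fun k => (-1 : SignType) ^ f k) = f (Fin.last m) := by
  rw [Fin.eq_add_sum_of_succ f (fun k => if (-1 : SignType) ^ f k.castSucc *
    (-1 : SignType) ^ f k.succ = -1 then 1 else 0), h0, zero_add, signChanges, Finset.card_filter]
  intro k
  rcases neg_one_pow_eq_or SignType (f k.castSucc) with h1 | h1 <;>
  rcases h k with h2 | h2 <;> simp [h2, pow_succ, h1]

namespace PlanarPolygon

variable {m : ℕ} {p : PlanarPolygon m} {O : Plane} {r : ℝ}

lemma InscribedIn.sub (h : p.InscribedIn O r) (k : Fin (m + 1)) : (p.sub k).InscribedIn O r :=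
  fun _ => h _

lemma sub_mem_moduliSpace {L : Fin (m + 3) → ℝ} (hp : p ∈ moduliSpace L) (k : Fin (m + 1)) :
    p.sub k ∈ moduliSpace (p.sub k).sideLengths := by
  have h0 : p.sub k 0 = p 0 := rfl
  have h1 : p.sub k 1 = p 1 := by
    refine congrArg p (Fin.ext ?_)
    simp
  refine ⟨rfl, h0.trans hp.2.1, ?_⟩
  rw [h1, hp.2.2, sideLengths, zero_add, h0, h1, ← hp.1, sideLengths, zero_add]

/-- In a generic cyclic polygon, no vertex is equal or opposite to the first one, as it is joined to
it by an edge of some subconfiguration. -/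
lemma IsGeneric.cross_first_ne_zero (h : p.InscribedIn O r) (hgen : p.IsGeneric O)
    (i : Fin (m + 3)) (hi : i ≠ 0) : cross (p 0 - O) (p i - O) ≠ 0 := by
  have hc := fun k => cross_vertex_ne_zero (h.sub k) (hgen.edge_ne k) (hgen.not_central k)
  by_cases h1 : i = 1
  · subst h1
    have := hc (Fin.last m) 0
    rwa [zero_add] at this
  · have hv0 : (i : ℕ) ≠ 0 := fun h => hi (Fin.ext h)
    have hv1 : (i : ℕ) ≠ 1 := fun h => h1 (Fin.ext (by simpa using h))
    have hlt := i.2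
    have := hc ⟨i - 2, by omega⟩ (Fin.last _)
    have hlast : p.sub ⟨i - 2, by omega⟩ (Fin.last _) = p i :=
      congrArg p (Fin.ext (by change (i : ℕ) - 2 + 2 = i; omega))
    rwa [Fin.last_add_one, cross_swap, neg_ne_zero, hlast] at this

lemma IsGeneric.sub_signature (h : p.InscribedIn O r) (hgen : p.IsGeneric O) (k : Fin (m + 1)) :
    Module.finrank ℝ (affineRelations fun i => p.sub k i - O) = k ∧
    FullRank (affineForm fun i => p.sub k i - O) ∧
    (-1 : SignType) ^ sigNeg (affineForm fun i => p.sub k i - O) =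
      -SignType.sign ((p.sub k).delta O) * (-1) ^ (p.sub k).numPositive O := by
  refine affineForm_signature (h.sub k) (hgen.edge_ne k) (hgen.not_central k) (fun i hi => ?_)
    (hgen.delta_ne k)
  refine hgen.cross_first_ne_zero h _ fun h0 => hi (Fin.ext ?_)
  have h1 := congrArg Fin.val h0
  exact h1

end PlanarPolygon

theorem theorem4p2 (m : ℕ) (L : Fin (m + 3) → ℝ) (p : PlanarPolygon m) (hp : p ∈ moduliSpace L)
    (O : Plane) (r : ℝ) (hcyclic : p.InscribedIn O r) (hgeneric : p.IsGeneric O) :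
    -- around `p` and all its subconfigurations the moduli spaces are manifolds
    Nonempty (LocalParam L p) ∧
    (∀ k, Nonempty (LocalParam (p.sub k).sideLengths (p.sub k))) ∧
    -- the following holds in all choices of local coordinates
    ∀ (ψ : LocalParam L p)
      (φ : ∀ k : Fin (m + 1), LocalParam (p.sub k).sideLengths (p.sub k)),
      ψ.IsCritical ∧ (∀ k, (φ k).IsCritical) ∧
      ψ.morseIndex = signChanges (hessSignSeq φ) ∧
      ∀ k, hessSignSeq φ k =
        -SignType.sign ((p.sub k).delta O) * (-1) ^ (p.sub k).numPositive O := by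
  have hsig := hgeneric.sub_signature hcyclic
  have hedge := hgeneric.edge_ne
  have hlast : ∀ i, p i ≠ p (i + 1) := hedge (Fin.last m)
  have hdim : Module.finrank ℝ (affineRelations fun i => p i - O) = m := (hsig (Fin.last m)).1
  refine ⟨PlanarPolygon.nonempty_localParam hp O hlast hdim, fun k =>
    PlanarPolygon.nonempty_localParam (PlanarPolygon.sub_mem_moduliSpace hp k) O (hedge k)
      (hsig k).1, fun ψ φ => ?_⟩
  set f : Fin (m + 1) → ℕ := fun k => sigNeg (affineForm fun i => p.sub k i - O) with hf
  have h0 : f 0 = 0 := by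
    have h1 := (hsig 0).2.1.trans (hsig 0).1
    exact (Nat.add_eq_zero_iff.mp h1).2
  have hseq : hessSignSeq φ = fun k => (-1 : SignType) ^ f k := by
    funext k
    rw [hessSignSeq]
    split_ifs with hk
    · rw [hk, h0, pow_zero]
    · exact (φ k).hessSign_eq (hcyclic.sub k) (hedge k) (hsig k).1 (hsig k).2.1
  refine ⟨ψ.isCritical hcyclic hlast, fun k => (φ k).isCritical (hcyclic.sub k) (hedge k), ?_,
    fun k => ?_⟩
  · rw [hseq, signChanges_neg_one_pow f h0 fun k => ?_]
    · exact ψ.morseIndex_eq hcyclic hlast hdim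
    · have h1 := hsig k.castSucc
      have h2 := hsig k.succ
      exact sigNeg_affineForm_snoc (n := k + 3) (fun i => p.sub k.succ i - O)
        (h2.1.trans (congrArg (· + 1) h1.1.symm)) h2.2.1 h1.2.1
  · rw [hseq]
    exact (hsig k).2.2
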